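/- Let $d\ge 1$ be an integer and let $\alpha>-2$ be real. For $N\ge 1$ write ${\mathbf V}=(v_1,\dots,v_N)$ with $v_i\in\mathbb R^d$, and let $\sigma$ be the (non-normalized) surface measure on the sphere $\mathcal S^{dN-1}(\sqrt N)\subset\mathbb R^{dN}$ of radius $\sqrt N$. Set $$F_N({\mathbf V})=\frac{1}{\widetilde Z_N}\Big(\sum_{i=1}^N|v_i|^{2+\alpha}\Big)^{-\frac{dN-1}{2+\alpha}},\qquad \widetilde Z_N=\int_{\mathcal S^{dN-1}(\sqrt N)}\Big(\sum_{i=1}^N|v_i|^{2+\alpha}\Big)^{-\frac{dN-1}{2+\alpha}}d\sigma({\mathbf V}),$$ $$c=\int_{\mathbb R^d}e^{-|v|^{2+\alpha}}dv,\qquad \mu=\frac1c\int_{\mathbb R^d}|v|^2e^{-|v|^{2+\alpha}}dv,\qquad f(v)=\frac{\mu^{d/2}}{c}\,e^{-(\sqrt\mu\,|v|)^{2+\alpha}}\quad(v\in\mathbb R^d).$$ A sequence $(L_N)_{N\ge1}$ of probability densities on $(\mathcal S^{dN-1}(\sqrt N),\sigma)$ is called *chaotic with marginal $l$*, where $l$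 is a probability density on $\mathbb R^d$, if for every $k$ and every bounded continuous $\varphi:(\mathbb R^d)^k\to\mathbb R$ $$\lim_{N\to\infty}\int_{\mathcal S^{dN-1}(\sqrt N)}\varphi(v_1,\dots,v_k)\,L_N({\mathbf V})\,d\sigma({\mathbf V})=\int_{\mathbb R^{dk}}\varphi(v_1,\dots,v_k)\prod_{j=1}^kl(v_j)\,dv_1\cdots dv_k .$$ It is called *entropically chaotic with marginal $l$* if in addition the integrals $S_N=\int_{\mathcal S^{dN-1}(\sqrt N)}L_N\log L_N\,d\sigma$ ($N\ge1$) and $\int_{\mathbb R^d}l\log l\,dv$ converge absolutely and $\lim_{N\to\infty}S_N/N=\int_{\mathbb R^d}l\log l\,dv$. Then the sequence $(F_N)_{N\ge1}$ is entropically chaotic with marginal $f$, and $$\lim_{N\to\infty}\frac1N\int_{\mathcal S^{dN-1}(\sqrt N)}F_N\log F_N\,d\sigma=\log\Big(\frac{\mu^{d/2}}{c}\Big)-\frac{d}{2+\alpha}=\int_{\mathbb R^d}f(v)\log f(v)\,dv .$$ -/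

import Mathlib

open MeasureTheory Filter Topology

noncomputable section

namespace SteadyState

/-- The velocity space `ℝ^d` of one particle, with its Euclidean norm. -/
abbrev Vel (d : ℕ) : Type := EuclideanSpace ℝ (Fin d)

/-- The velocity space `ℝ^(dN)` of `N` particles: `V = (v_1, …, v_N)` with the Euclidean norm
`|V|² = ∑ |v_i|²`. The particle indices `1, …, N` are the elements of `Fin N`. -/
abbrev Conf (d N : ℕ) : Type := PiLp 2 (fun _ : Fin N => Vel d)

/-- The (non-normalized) surface measure on the sphere of radius `R > 0` about the origin of an
`n`-dimensional Euclidean space `E`, regarded as a measure on `E`: `R^(n-1)` times the image of the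
surface measure of the unit sphere under `w ↦ R w`. Mathlib's `Measure.toSphere` of Lebesgue measure
is the surface measure of the unit sphere, the one that appears in polar coordinates. -/
def surfaceMeasure (E : Type*) [NormedAddCommGroup E] [InnerProductSpace ℝ E]
    [FiniteDimensional ℝ E] [MeasurableSpace E] [BorelSpace E] (R : ℝ) : Measure E :=
  ENNReal.ofReal (R ^ (Module.finrank ℝ E - 1)) •
    (volume : Measure E).toSphere.map (fun w : Metric.sphere (0 : E) 1 => R • (w : E))

/-- The surface measure `σ` on the energy sphere `S^(dN-1)(√N)`, for `N ≥ 1`. -/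
def energySurface (d N : ℕ) : Measure (Conf d N) := surfaceMeasure (Conf d N) (Real.sqrt N)

/-- `l` is a probability density with respect to the measure `m`. -/
structure IsProbDensity {X : Type*} [MeasurableSpace X] (m : Measure X) (l : X → ℝ) : Prop where
  nonneg : ∀ᵐ x ∂m, 0 ≤ l x
  integrable : Integrable l m
  integral_eq_one : ∫ x, l x ∂m = 1

/-- The sequence `(L_N)`, `N ≥ 1`, of densities on the energy spheres is chaotic with marginal `l`:
for every `k` and every bounded continuous `φ` of `k` velocities,
`∫ φ(v_1, …, v_k) L_N(V) dσ(V) → ∫ φ(v_1, …, v_k) ∏ l(v_j) dv_1 ⋯ dv_k` as `N → ∞`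
(the limit is written along `N = k + m`, `m → ∞`, so that the first `k` velocities exist).
For `k = 1` this says that `l` is the limit of the one-particle marginals of `L_N`. -/
structure IsChaotic (d : ℕ) (L : (N : ℕ) → Conf d N → ℝ) (l : Vel d → ℝ) : Prop where
  density : ∀ N : ℕ, 1 ≤ N → IsProbDensity (energySurface d N) (L N)
  marginal_density : IsProbDensity volume l
  tendsto_marginal : ∀ (k : ℕ) (φ : BoundedContinuousFunction (Fin k → Vel d) ℝ),
    Tendsto
      (fun m : ℕ =>
        ∫ V, φ (fun j : Fin k => V (Fin.castAdd m j)) * L (k + m) V ∂(energySurface d (k + m)))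
      atTop (𝓝 (∫ v : Fin k → Vel d, φ v * ∏ j, l (v j)))

/-- The entropy `S_N = ∫ L log L dσ` of a density `L` on the energy sphere of `N` particles
(with the convention `0 log 0 = 0`). -/
def entropy (d N : ℕ) (L : Conf d N → ℝ) : ℝ :=
  ∫ V, L V * Real.log (L V) ∂(energySurface d N)

/-- The sequence `(L_N)` is entropically chaotic with marginal `l`: it is chaotic with marginal `l`,
all the entropies exist, and the entropy per particle converges to the entropy of `l`. -/
structure IsEntropicallyChaotic (d : ℕ) (L : (N : ℕ) → Conf d N → ℝ) (l : Vel d → ℝ) : Prop where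
  chaotic : IsChaotic d L l
  integrable_entropy : ∀ N : ℕ, 1 ≤ N →
    Integrable (fun V => L N V * Real.log (L N V)) (energySurface d N)
  integrable_marginal_entropy : Integrable (fun v => l v * Real.log (l v)) volume
  tendsto_entropy :
    Tendsto (fun N : ℕ => entropy d N (L N) / (N : ℝ)) atTop (𝓝 (∫ v, l v * Real.log (l v)))

/-- The unnormalized stationary weight `(∑ |v_i|^(2+α))^(-(dN-1)/(2+α))`. -/
def weight (d : ℕ) (α : ℝ) (N : ℕ) (V : Conf d N) : ℝ :=
  1 / (∑ i, ‖V i‖ ^ (2 + α)) ^ (((d : ℝ) * (N : ℝ) - 1) / (2 + α))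

/-- The normalization constant of the stationary weight on `S^(dN-1)(√N)`. -/
def normalization (d : ℕ) (α : ℝ) (N : ℕ) : ℝ :=
  ∫ V, weight d α N V ∂(energySurface d N)

/-- The stationary density `F_N` on `S^(dN-1)(√N)`. -/
def steadyDensity (d : ℕ) (α : ℝ) (N : ℕ) (V : Conf d N) : ℝ :=
  1 / normalization d α N * weight d α N V

/-- The constant `c = ∫ exp(-|v|^(2+α)) dv`. -/
def constC (d : ℕ) (α : ℝ) : ℝ := ∫ v : Vel d, Real.exp (-‖v‖ ^ (2 + α))

/-- The constant `μ = c⁻¹ ∫ |v|² exp(-|v|^(2+α)) dv`. -/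
def constMu (d : ℕ) (α : ℝ) : ℝ :=
  1 / constC d α * ∫ v : Vel d, ‖v‖ ^ 2 * Real.exp (-‖v‖ ^ (2 + α))

/-- The one-particle density `f(v) = (μ^(d/2) / c) exp(-(√μ |v|)^(2+α))`. -/
def limitDensity (d : ℕ) (α : ℝ) (v : Vel d) : ℝ :=
  constMu d α ^ ((d : ℝ) / 2) / constC d α *
    Real.exp (-(Real.sqrt (constMu d α) * ‖v‖) ^ (2 + α))

end SteadyState

end

/-!
Write `p = 2 + α` and `n = dN`. Take independent velocities `X_1, X_2, …` with density
`exp (-|v|^p) / c` (`iidLaw`) and project the first `N` of them radially to the energy sphere,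
`V = √N X / |X|` (`sphereConf`). Since `∑ |v_i|^p` is homogeneous of degree `p`, integration in
polar coordinates (`lintegral_radial_exp_neg_homogeneous`) shows that `V` has a density proportional
to `(∑ |v_i|^p)^(-n/p)` on the sphere (`map_sphereConf_iidLaw`). The stationary density has exponent
`-(n-1)/p` instead, so it is the law of `V` reweighted by the power mean
`R_N = ((1/N) ∑ |V_i|^p)^(1/p)` (`speedMean`): `∫ φ F_N dσ = E[φ(V) R_N] / E[R_N]`
(`integral_mul_steadyDensity`), and the normalization constant is `E[R_N]` divided by an explicit
factor `c⁻ᴺ Γ(n/p) N^(1/2 - 1/p) / p` (`normalization_eq`).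

In terms of the independent velocities, `R_N` is the `p`-th power mean of the speeds divided by
their root mean square. By the strong law of large numbers, almost surely `R_N` tends to the
constant `ρ = (d/p)^(1/p) / √μ` and each `V_j` tends to `X_j / √μ`, whose density is `f`. To pass to
the limit in expectations it suffices that `E[R_N⁴]` is bounded
(`exists_integral_speedMean_pow_four_le`): where the mean energy of the `X_i` is bounded below, `R_N`
is controlled by the moments of the `X_i`; elsewhere `R_N ≤ √N` on an event of exponentially small
probability. This gives chaoticity, and also `E[R_N] → ρ` and `E[R_N log R_N] → ρ log ρ`.

Finally `log F_N` is an affine function of `log R_N`, so the entropy is expressed exactly through the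
normalization constant and `E[R_N log R_N] / E[R_N]` (`entropy_steadyDensity`). Stirling's formula
to leading order (`tendsto_log_Gamma_mul_natCast`) evaluates the Gamma factor; the terms of order
`log N` cancel, and the limit is the entropy of `f`.
-/

/-! ### Product measures -/

section Measures

open scoped ENNReal

theorem MeasureTheory.Measure.pi_withDensity_ofReal {ι X : Type*} [Fintype ι] [MeasurableSpace X]
    (m : Measure X) [SigmaFinite m] (g : X → ℝ) (hg0 : ∀ x, 0 ≤ g x)
    (hgi : Integrable g m) :
    Measure.pi (fun _ : ι => m.withDensity fun x => ENNReal.ofReal (g x)) =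
      (Measure.pi fun _ : ι => m).withDensity fun x => ENNReal.ofReal (∏ i, g (x i)) := by
  have hfin : IsFiniteMeasure (m.withDensity fun x => ENNReal.ofReal (g x)) :=
    isFiniteMeasure_withDensity_ofReal hgi.2
  refine Measure.pi_eq fun s hs => ?_
  have hps : MeasurableSet (Set.univ.pi s) := MeasurableSet.univ_pi hs
  have hind : ∀ x : ι → X, (Set.univ.pi s).indicator (fun x => ∏ i, g (x i)) x =
      ∏ i, (s i).indicator g (x i) := by
    intro x
    by_cases hx : x ∈ Set.univ.pi s
    · rw [Set.indicator_of_mem hx]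
      exact Finset.prod_congr rfl fun i _ => (Set.indicator_of_mem (hx i trivial) _).symm
    · rw [Set.indicator_of_notMem hx]
      simp only [Set.mem_pi, Set.mem_univ, true_implies, not_forall] at hx
      obtain ⟨i, hi⟩ := hx
      exact (Finset.prod_eq_zero (Finset.mem_univ i) (Set.indicator_of_notMem hi _)).symm
  have hprod : Integrable (fun x : ι → X => ∏ i, g (x i)) (Measure.pi fun _ => m) :=
    Integrable.fintype_prod fun _ => hgi
  rw [withDensity_apply _ hps, ← ofReal_integral_eq_lintegral_ofReal hprod.restrict
    (Eventually.of_forall fun x => Finset.prod_nonneg fun i _ => hg0 _),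
    ← integral_indicator hps]
  simp_rw [hind]
  rw [integral_fintype_prod_eq_prod (f := fun i x => (s i).indicator g x),
    ENNReal.ofReal_prod_of_nonneg fun i _ =>
      integral_nonneg fun x => Set.indicator_nonneg (fun x _ => hg0 x) x]
  refine Finset.prod_congr rfl fun i _ => ?_
  rw [withDensity_apply _ (hs i), integral_indicator (hs i),
    ofReal_integral_eq_lintegral_ofReal hgi.restrict (Eventually.of_forall hg0)]

/-- The Lebesgue measure of a Euclidean product is the product of the Lebesgue measures. Both are
Haar measures, and they give the Gaussian function `exp (-‖x‖²)` the same integral. -/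
theorem PiLp.measurePreserving_ofLp_volume {ι E : Type*} [Fintype ι] [NormedAddCommGroup E]
    [InnerProductSpace ℝ E] [FiniteDimensional ℝ E] [MeasurableSpace E] [BorelSpace E] :
    MeasurePreserving (WithLp.ofLp : PiLp 2 (fun _ : ι => E) → ι → E) volume volume := by
  let e : PiLp 2 (fun _ : ι => E) ≃L[ℝ] (ι → E) := PiLp.continuousLinearEquiv 2 ℝ (fun _ : ι => E)
  have he : Measurable (WithLp.ofLp : PiLp 2 (fun _ : ι => E) → ι → E) :=
    e.continuous.measurable
  refine ⟨he, ?_⟩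
  have hhaar : ((volume : Measure (PiLp 2 (fun _ : ι => E))).map e).IsAddHaarMeasure :=
    e.isAddHaarMeasure_map _
  change (volume : Measure (PiLp 2 (fun _ : ι => E))).map e = volume
  rw [Measure.isAddLeftInvariant_eq_smul ((volume : Measure (PiLp 2 (fun _ : ι => E))).map e) volume]
  set c := Measure.addHaarScalarFactor
    ((volume : Measure (PiLp 2 (fun _ : ι => E))).map e) volume with hc
  have hmap := Measure.isAddLeftInvariant_eq_smul
    ((volume : Measure (PiLp 2 (fun _ : ι => E))).map e) volume
  rw [← hc] at hmap
  have h1 : ∫ x : ι → E, Real.exp (-1 * ∑ i, ‖x i‖ ^ 2)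
      ∂((volume : Measure (PiLp 2 (fun _ : ι => E))).map e) =
      (Real.pi / 1) ^ (Module.finrank ℝ (PiLp 2 (fun _ : ι => E)) / 2 : ℝ) := by
    rw [integral_map e.continuous.aemeasurable
      (Continuous.aestronglyMeasurable (by fun_prop)), ← GaussianFourier.integral_rexp_neg_mul_sq_norm one_pos]
    refine integral_congr_ae (Eventually.of_forall fun x => ?_)
    simp only [PiLp.norm_sq_eq_of_L2]
    rfl
  have h2 : ∫ x : ι → E, Real.exp (-1 * ∑ i, ‖x i‖ ^ 2) =
      (Real.pi / 1) ^ (Module.finrank ℝ (PiLp 2 (fun _ : ι => E)) / 2 : ℝ) := by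
    have : ∀ x : ι → E, Real.exp (-1 * ∑ i, ‖x i‖ ^ 2) = ∏ i, Real.exp (-1 * ‖x i‖ ^ 2) := by
      intro x
      rw [Finset.mul_sum, Real.exp_sum]
    simp_rw [this]
    rw [volume_pi, integral_fintype_prod_eq_pow (fun y : E => Real.exp (-1 * ‖y‖ ^ 2)),
      GaussianFourier.integral_rexp_neg_mul_sq_norm one_pos, e.toLinearEquiv.finrank_eq,
      Module.finrank_pi_fintype, ← Real.rpow_natCast, ← Real.rpow_mul (by positivity)]
    simp
    ring_nf
  rw [hmap, integral_smul_nnreal_measure, h2] at h1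
  have hpos : (0 : ℝ) < (Real.pi / 1) ^ (Module.finrank ℝ (PiLp 2 (fun _ : ι => E)) / 2 : ℝ) := by
    positivity
  have hc1 : (c : ℝ) = 1 := by
    rw [NNReal.smul_def, smul_eq_mul] at h1
    exact mul_right_cancel₀ hpos.ne' (h1.trans (one_mul _).symm)
  rw [NNReal.coe_eq_one.mp hc1, one_smul]

end Measures

/-! ### Polar coordinates for homogeneous exponents -/

section Polar

open scoped ENNReal

variable {E : Type*} [NormedAddCommGroup E] [InnerProductSpace ℝ E] [FiniteDimensional ℝ E]
  [MeasurableSpace E] [BorelSpace E]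

theorem lintegral_volumeIoiPow_exp_neg_mul_rpow {p b : ℝ} (hp : 0 < p) (hb : 0 < b) {n : ℕ}
    (hn : 1 ≤ n) :
    ∫⁻ r, ENNReal.ofReal (Real.exp (-b * (r : ℝ) ^ p)) ∂(Measure.volumeIoiPow (n - 1)) =
      ENNReal.ofReal (Real.Gamma (n / p) / p * b ^ (-((n : ℝ) / p))) := by
  have hq : (-1 : ℝ) < (n : ℝ) - 1 := by
    have : (1 : ℝ) ≤ n := by exact_mod_cast hn
    linarith
  rw [Measure.volumeIoiPow, lintegral_withDensity_eq_lintegral_mul _ (by fun_prop) (by fun_prop)]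
  simp only [Pi.mul_apply]
  rw [lintegral_subtype_comap measurableSet_Ioi
    (fun r : ℝ => ENNReal.ofReal (r ^ (n - 1)) * ENNReal.ofReal (Real.exp (-b * r ^ p)))]
  have hcongr : ∀ r ∈ Set.Ioi (0 : ℝ),
      ENNReal.ofReal (r ^ (n - 1)) * ENNReal.ofReal (Real.exp (-b * r ^ p)) =
        ENNReal.ofReal (r ^ ((n : ℝ) - 1) * Real.exp (-b * r ^ p)) := by
    intro r hr
    have hr' : (0 : ℝ) < r := hr
    rw [← ENNReal.ofReal_mul (by positivity), ← Real.rpow_natCast, Nat.cast_sub hn, Nat.cast_one]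
  rw [setLIntegral_congr_fun measurableSet_Ioi hcongr, ← ofReal_integral_eq_lintegral_ofReal
    (integrableOn_rpow_mul_exp_neg_mul_rpow hq hp hb)
    ((ae_restrict_mem measurableSet_Ioi).mono fun r hr => by
      have hr' : (0 : ℝ) < r := hr
      positivity), integral_rpow_mul_exp_neg_mul_rpow hp hq hb]
  congr 1
  rw [show (n : ℝ) - 1 + 1 = n by ring, neg_div]
  ring

/-- Integration in polar coordinates against `exp (-S)`, for `S` positively homogeneous of degree
`p`, of a function of the direction: on each ray the radial integral is a Gamma integral. -/
theorem lintegral_radial_exp_neg_homogeneous [Nontrivial E] {p R : ℝ} (hp : 0 < p) (hR : 0 < R)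
    {S : E → ℝ} (hS : Measurable S) (hSpos : ∀ x, x ≠ 0 → 0 < S x)
    (hShom : ∀ r : ℝ, 0 < r → ∀ x, S (r • x) = r ^ p * S x)
    {H : E → ℝ≥0∞} (hH : Measurable H) :
    ∫⁻ x : E, H ((R / ‖x‖) • x) * ENNReal.ofReal (Real.exp (-S x)) =
      ENNReal.ofReal (Real.Gamma (Module.finrank ℝ E / p) / p * R) *
        ∫⁻ V, H V * ENNReal.ofReal (S V ^ (-((Module.finrank ℝ E : ℝ) / p)))
          ∂(SteadyState.surfaceMeasure E R) := by
  set n := Module.finrank ℝ E with hn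
  have hn1 : 1 ≤ n := Module.finrank_pos
  have hG : 0 < Real.Gamma (n / p) := Real.Gamma_pos_of_pos (by positivity)
  have hHR : Measurable fun w : Metric.sphere (0 : E) 1 => H (R • (w : E)) := by fun_prop
  have hSw : Measurable fun w : Metric.sphere (0 : E) 1 => S (w : E) := by fun_prop
  have hSw_pos : ∀ w : Metric.sphere (0 : E) 1, 0 < S (w : E) := fun w =>
    hSpos _ (Metric.ne_of_mem_sphere w.2 one_ne_zero)
  -- The left-hand side as an integral over the unit sphere, after the radial integration.
  have hleft : ∫⁻ x : E, H ((R / ‖x‖) • x) * ENNReal.ofReal (Real.exp (-S x)) =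
      ∫⁻ w, H (R • (w : E)) * ENNReal.ofReal (Real.Gamma (n / p) / p * S (w : E) ^ (-((n : ℝ) / p)))
        ∂(volume : Measure E).toSphere := by
    have hm := (volume : Measure E).measurePreserving_homeomorphUnitSphereProd
    calc ∫⁻ x : E, H ((R / ‖x‖) • x) * ENNReal.ofReal (Real.exp (-S x))
        = ∫⁻ x : ({(0)}ᶜ : Set E), H ((R / ‖(x : E)‖) • (x : E)) *
            ENNReal.ofReal (Real.exp (-S x)) ∂((volume : Measure E).comap (↑)) := by
          rw [lintegral_subtype_comap (measurableSet_singleton _).compl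
            fun x => H ((R / ‖x‖) • x) * ENNReal.ofReal (Real.exp (-S x)),
            restrict_compl_singleton]
      _ = ∫⁻ q, H (R • (q.1 : E)) *
            ENNReal.ofReal (Real.exp (-S (q.1 : E) * (q.2 : ℝ) ^ p))
            ∂((volume : Measure E).toSphere.prod (.volumeIoiPow (n - 1))) := by
          rw [← hm.lintegral_comp (by fun_prop)]
          refine lintegral_congr fun x => ?_
          have hx : (x : E) ≠ 0 := x.2
          have hx' : 0 < ‖(x : E)‖ := norm_pos_iff.mpr hx
          have hxS : S (x : E) = ‖(x : E)‖ ^ p * S (‖(x : E)‖⁻¹ • (x : E)) := by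
            rw [← hShom _ hx', smul_smul, mul_inv_cancel₀ hx'.ne', one_smul]
          simp only [homeomorphUnitSphereProd_apply_fst_coe, homeomorphUnitSphereProd_apply_snd_coe]
          rw [hxS, smul_smul, div_eq_mul_inv]
          congr 3
          ring
      _ = ∫⁻ w, ∫⁻ r, H (R • (w : E)) *
            ENNReal.ofReal (Real.exp (-S (w : E) * (r : ℝ) ^ p))
            ∂(Measure.volumeIoiPow (n - 1)) ∂(volume : Measure E).toSphere := by
          rw [lintegral_prod _ (by fun_prop)]
      _ = _ := by
          refine lintegral_congr fun w => ?_
          rw [lintegral_const_mul _ (by fun_prop),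
            lintegral_volumeIoiPow_exp_neg_mul_rpow hp (hSw_pos w) hn1]
  rw [hleft, SteadyState.surfaceMeasure, lintegral_smul_measure,
    lintegral_map (by fun_prop) (by fun_prop), smul_eq_mul, ← mul_assoc,
    ← lintegral_const_mul _ (by fun_prop), ← hn]
  refine lintegral_congr fun w => ?_
  have hw := hSw_pos w
  rw [hShom R hR, Real.mul_rpow (by positivity) hw.le, ← Real.rpow_mul hR.le,
    mul_left_comm, ← ENNReal.ofReal_mul (by positivity), ← ENNReal.ofReal_mul (by positivity)]
  congr 2
  -- The powers of `R` from the surface measure and from `S` cancel up to one factor `R`.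
  have : R * R ^ (n - 1) * R ^ (p * -((n : ℝ) / p)) = 1 := by
    rw [← pow_succ', Nat.sub_add_cancel hn1, ← Real.rpow_natCast, ← Real.rpow_add hR]
    rw [show (n : ℝ) + p * -((n : ℝ) / p) = 0 by field_simp; ring, Real.rpow_zero]
  calc _ = Real.Gamma (n / p) / p * S w ^ (-((n : ℝ) / p)) *
        (R * R ^ (n - 1) * R ^ (p * -((n : ℝ) / p))) := by rw [this, mul_one]
    _ = _ := by ring

end Polar

namespace SteadyState

/-! ### The one-particle law -/

section OneParticle

variable {d : ℕ} {α : ℝ}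

/-- The law on `ℝ^d` with density `exp (-|v|^(2+α)) / c`. -/
noncomputable def particleLaw (d : ℕ) (α : ℝ) : Measure (Vel d) :=
  volume.withDensity fun v => ENNReal.ofReal (Real.exp (-‖v‖ ^ (2 + α)) / constC d α)

theorem integrable_norm_rpow_mul_exp (hd : 1 ≤ d) (hα : -2 < α) {s : ℝ} (hs : 0 ≤ s) :
    Integrable fun v : Vel d => ‖v‖ ^ s * Real.exp (-‖v‖ ^ (2 + α)) := by
  have hd' : (1 : ℝ) ≤ d := by exact_mod_cast hd
  have : Nonempty (Fin d) := ⟨⟨0, hd⟩⟩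
  rw [integrable_fun_norm_addHaar (volume : Measure (Vel d))
    (f := fun r : ℝ => r ^ s * Real.exp (-r ^ (2 + α))), finrank_euclideanSpace_fin]
  refine (integrableOn_rpow_mul_exp_neg_rpow (s := (d : ℝ) - 1 + s) (p := 2 + α)
    (by linarith) (by linarith)).congr_fun (fun r hr => ?_) measurableSet_Ioi
  have hr' : (0 : ℝ) < r := hr
  simp only [smul_eq_mul]
  rw [Real.rpow_add hr' ((d : ℝ) - 1) s, ← Real.rpow_natCast r (d - 1), Nat.cast_sub hd, Nat.cast_one]
  ring

theorem integral_norm_rpow_mul_exp (hd : 1 ≤ d) (hα : -2 < α) {s : ℝ} (hs : 0 ≤ s) :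
    ∫ v : Vel d, ‖v‖ ^ s * Real.exp (-‖v‖ ^ (2 + α)) =
      d * (volume : Measure (Vel d)).real (Metric.ball 0 1) *
        (1 / (2 + α) * Real.Gamma ((d + s) / (2 + α))) := by
  have hd' : (1 : ℝ) ≤ d := by exact_mod_cast hd
  have : Nonempty (Fin d) := ⟨⟨0, hd⟩⟩
  rw [integral_fun_norm_addHaar (volume : Measure (Vel d))
    (fun r : ℝ => r ^ s * Real.exp (-r ^ (2 + α))), finrank_euclideanSpace_fin, nsmul_eq_mul,
    smul_eq_mul, ← mul_assoc]
  congr 1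
  rw [show (d : ℝ) + s = (d : ℝ) - 1 + s + 1 by ring,
    ← integral_rpow_mul_exp_neg_rpow (p := 2 + α) (by linarith) (by linarith)]
  refine setIntegral_congr_fun measurableSet_Ioi fun r hr => ?_
  have hr' : (0 : ℝ) < r := hr
  simp only [smul_eq_mul]
  rw [Real.rpow_add hr' ((d : ℝ) - 1) s, ← Real.rpow_natCast r (d - 1), Nat.cast_sub hd, Nat.cast_one]
  ring

theorem integrable_exp_neg_norm_rpow (hd : 1 ≤ d) (hα : -2 < α) :
    Integrable fun v : Vel d => Real.exp (-‖v‖ ^ (2 + α)) := by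
  simpa using integrable_norm_rpow_mul_exp hd hα le_rfl

theorem integral_norm_rpow_mul_exp_pos (hd : 1 ≤ d) (hα : -2 < α) {s : ℝ} (hs : 0 ≤ s) :
    0 < ∫ v : Vel d, ‖v‖ ^ s * Real.exp (-‖v‖ ^ (2 + α)) := by
  have hd' : (1 : ℝ) ≤ d := by exact_mod_cast hd
  have hp : 0 < 2 + α := by linarith
  rw [integral_norm_rpow_mul_exp hd hα hs]
  have h1 : 0 < (volume : Measure (Vel d)).real (Metric.ball 0 1) :=
    ENNReal.toReal_pos (Metric.measure_ball_pos _ _ one_pos).ne' measure_ball_lt_top.ne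
  have h2 : 0 < Real.Gamma ((d + s) / (2 + α)) := Real.Gamma_pos_of_pos (by positivity)
  positivity

theorem constC_pos (hd : 1 ≤ d) (hα : -2 < α) : 0 < constC d α := by
  simpa [constC] using integral_norm_rpow_mul_exp_pos hd hα le_rfl

theorem constMu_pos (hd : 1 ≤ d) (hα : -2 < α) : 0 < constMu d α := by
  have h := integral_norm_rpow_mul_exp_pos hd hα (s := 2) (by norm_num)
  simp only [Real.rpow_two] at h
  have := constC_pos hd hα
  rw [constMu]
  positivity

theorem isProbabilityMeasure_particleLaw (hd : 1 ≤ d) (hα : -2 < α) :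
    IsProbabilityMeasure (particleLaw d α) := by
  have hc := constC_pos hd hα
  refine ⟨?_⟩
  rw [particleLaw, withDensity_apply _ .univ, Measure.restrict_univ,
    ← ofReal_integral_eq_lintegral_ofReal ((integrable_exp_neg_norm_rpow hd hα).div_const _)
      (Eventually.of_forall fun v => by positivity), integral_div, ← constC, div_self hc.ne',
    ENNReal.ofReal_one]

theorem integral_particleLaw (hd : 1 ≤ d) (hα : -2 < α) (h : Vel d → ℝ) :
    ∫ v, h v ∂(particleLaw d α) =
      1 / constC d α * ∫ v, h v * Real.exp (-‖v‖ ^ (2 + α)) := by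
  have hc := constC_pos hd hα
  rw [particleLaw, integral_withDensity_eq_integral_toReal_smul
    (by fun_prop) (Eventually.of_forall fun _ => ENNReal.ofReal_lt_top), ← integral_const_mul]
  refine integral_congr_ae (Eventually.of_forall fun v => ?_)
  simp only [smul_eq_mul]
  rw [ENNReal.toReal_ofReal (by positivity)]
  ring

theorem integrable_particleLaw_iff (hd : 1 ≤ d) (hα : -2 < α) (h : Vel d → ℝ) :
    Integrable h (particleLaw d α) ↔
      Integrable fun v => h v * Real.exp (-‖v‖ ^ (2 + α)) := by
  have hc := constC_pos hd hα
  rw [particleLaw, integrable_withDensity_iff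
    (by fun_prop) (Eventually.of_forall fun _ => ENNReal.ofReal_lt_top)]
  rw [← integrable_const_mul_iff (c := constC d α) (IsUnit.mk0 _ hc.ne')]
  refine integrable_congr (Eventually.of_forall fun v => ?_)
  simp only
  rw [ENNReal.toReal_ofReal (by positivity)]
  field_simp

theorem integrable_norm_rpow_particleLaw (hd : 1 ≤ d) (hα : -2 < α) {s : ℝ} (hs : 0 ≤ s) :
    Integrable (fun v => ‖v‖ ^ s) (particleLaw d α) :=
  (integrable_particleLaw_iff hd hα _).mpr (integrable_norm_rpow_mul_exp hd hα hs)

theorem integrable_norm_sq_particleLaw (hd : 1 ≤ d) (hα : -2 < α) :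
    Integrable (fun v => ‖v‖ ^ 2) (particleLaw d α) := by
  simpa using integrable_norm_rpow_particleLaw hd hα (s := 2) (by norm_num)

theorem integral_norm_sq_particleLaw (hd : 1 ≤ d) (hα : -2 < α) :
    ∫ v, ‖v‖ ^ 2 ∂(particleLaw d α) = constMu d α := by
  rw [integral_particleLaw hd hα, constMu]

/-- The moment of order `2 + α` is a ratio of Gamma values that differ by one in the argument. -/
theorem integral_norm_rpow_particleLaw (hd : 1 ≤ d) (hα : -2 < α) :
    ∫ v, ‖v‖ ^ (2 + α) ∂(particleLaw d α) = d / (2 + α) := by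
  have hd' : (1 : ℝ) ≤ d := by exact_mod_cast hd
  have hp : 0 < 2 + α := by linarith
  have h0 := integral_norm_rpow_mul_exp hd hα (s := 0) le_rfl
  simp only [Real.rpow_zero, one_mul, add_zero] at h0
  have hc := constC_pos hd hα
  rw [constC, h0] at hc
  rw [integral_particleLaw hd hα, constC, h0, integral_norm_rpow_mul_exp hd hα hp.le, add_div,
    div_self hp.ne', Real.Gamma_add_one (by positivity)]
  have hG : Real.Gamma (d / (2 + α)) ≠ 0 := (Real.Gamma_pos_of_pos (by positivity)).ne'
  have hb := right_ne_zero_of_mul (left_ne_zero_of_mul hc.ne')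
  field_simp

theorem particleLaw_absolutelyContinuous : particleLaw d α ≪ volume :=
  withDensity_absolutelyContinuous _ _

theorem integrable_exp_neg_norm_sq_particleLaw (hd : 1 ≤ d) (hα : -2 < α) :
    Integrable (fun v : Vel d => Real.exp (-‖v‖ ^ 2)) (particleLaw d α) := by
  have := isProbabilityMeasure_particleLaw hd hα
  refine Integrable.mono' (integrable_const (1 : ℝ))
    (Continuous.aestronglyMeasurable (by fun_prop)) (Eventually.of_forall fun v => ?_)
  rw [Real.norm_eq_abs, abs_of_pos (Real.exp_pos _), Real.exp_le_one_iff]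
  have := sq_nonneg ‖v‖
  linarith

theorem integral_exp_neg_norm_sq_particleLaw_lt_one (hd : 1 ≤ d) (hα : -2 < α) :
    ∫ v, Real.exp (-‖v‖ ^ 2) ∂(particleLaw d α) < 1 := by
  have hprob := isProbabilityMeasure_particleLaw hd hα
  have : Nonempty (Fin d) := ⟨⟨0, hd⟩⟩
  have hne : ∀ᵐ v ∂(particleLaw d α), v ≠ 0 := by
    refine particleLaw_absolutelyContinuous.ae_le ?_
    exact Measure.ae_ne volume 0
  have hint : Integrable (fun v => 1 - Real.exp (-‖v‖ ^ 2)) (particleLaw d α) :=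
    (integrable_const (1 : ℝ)).sub (integrable_exp_neg_norm_sq_particleLaw hd hα)
  have hpos : 0 < ∫ v, (1 - Real.exp (-‖v‖ ^ 2)) ∂(particleLaw d α) := by
    rw [integral_pos_iff_support_of_nonneg_ae _ hint]
    · have : (Function.support fun v : Vel d => 1 - Real.exp (-‖v‖ ^ 2)) =ᵐ[particleLaw d α]
          Set.univ := by
        filter_upwards [hne] with v hv
        refine propext ⟨fun _ => trivial, fun _ => ?_⟩
        have h : Real.exp (-‖v‖ ^ 2) < 1 := by
          rw [Real.exp_lt_one_iff]
          have := norm_pos_iff.mpr hv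
          nlinarith
        exact (sub_pos.mpr h).ne'
      rw [measure_congr this, measure_univ]
      exact one_pos
    · refine Eventually.of_forall fun v => sub_nonneg.mpr ?_
      rw [Real.exp_le_one_iff]
      have := sq_nonneg ‖v‖
      linarith
  rw [integral_sub (integrable_const _) (integrable_exp_neg_norm_sq_particleLaw hd hα)] at hpos
  simp at hpos
  linarith

end OneParticle

/-! ### Independent velocities -/

section IID

variable {d : ℕ} {α : ℝ}

/-- The law of a sequence of independent velocities with common law `particleLaw d α`. -/
noncomputable def iidLaw (d : ℕ) (α : ℝ) : Measure (ℕ → Vel d) :=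
  Measure.infinitePi fun _ => particleLaw d α

/-- The configuration of the first `N` velocities of a sequence. -/
def initialConf (d N : ℕ) (ω : ℕ → Vel d) : Conf d N :=
  WithLp.toLp 2 fun i : Fin N => ω i

theorem measurable_initialConf (N : ℕ) : Measurable (initialConf d N) := by
  unfold initialConf
  fun_prop

theorem isProbabilityMeasure_iidLaw (hd : 1 ≤ d) (hα : -2 < α) :
    IsProbabilityMeasure (iidLaw d α) := by
  have := isProbabilityMeasure_particleLaw hd hα
  unfold iidLaw
  infer_instance

theorem map_eval_iidLaw (hd : 1 ≤ d) (hα : -2 < α) (i : ℕ) :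
    (iidLaw d α).map (fun ω => ω i) = particleLaw d α := by
  have := isProbabilityMeasure_particleLaw hd hα
  exact Measure.infinitePi_map_eval (fun _ : ℕ => particleLaw d α) i

theorem map_restrict_iidLaw (hd : 1 ≤ d) (hα : -2 < α) (N : ℕ) :
    (iidLaw d α).map (fun ω (i : Fin N) => ω i) = Measure.pi fun _ => particleLaw d α := by
  have := isProbabilityMeasure_particleLaw hd hα
  rw [← Measure.infinitePi_eq_pi]
  exact Measure.map_infinitePi_infinitePi_of_inj (P := fun _ : ℕ => particleLaw d α)
    (f := fun i : Fin N => (i : ℕ)) Fin.val_injective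

theorem ae_tendsto_average_iidLaw (hd : 1 ≤ d) (hα : -2 < α) {h : Vel d → ℝ} (hm : Measurable h)
    (hi : Integrable h (particleLaw d α)) :
    ∀ᵐ ω ∂(iidLaw d α), Tendsto (fun N : ℕ => (∑ i : Fin N, h (ω i)) / N) atTop
      (𝓝 (∫ v, h v ∂(particleLaw d α))) := by
  have := isProbabilityMeasure_particleLaw hd hα
  have hmp : ∀ i : ℕ, Measurable fun ω : ℕ → Vel d => ω i := fun i => measurable_pi_apply i
  have hind : ProbabilityTheory.iIndepFun (fun (i : ℕ) ω => h (ω i)) (iidLaw d α) :=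
    ProbabilityTheory.iIndepFun_infinitePi (X := fun _ => h) fun _ => hm
  have hident : ∀ i : ℕ, ProbabilityTheory.IdentDistrib (fun ω : ℕ → Vel d => h (ω i))
      (fun ω => h (ω 0)) (iidLaw d α) (iidLaw d α) := by
    intro i
    have : ProbabilityTheory.IdentDistrib (fun ω : ℕ → Vel d => ω i)
      (fun ω => ω 0) (iidLaw d α) (iidLaw d α) :=
      ⟨(hmp i).aemeasurable, (hmp 0).aemeasurable, by
        rw [map_eval_iidLaw hd hα, map_eval_iidLaw hd hα]⟩
    exact this.comp hm
  have hint : Integrable (fun ω : ℕ → Vel d => h (ω 0)) (iidLaw d α) := by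
    rw [← map_eval_iidLaw hd hα 0] at hi
    exact hi.comp_measurable (hmp 0)
  have hE : ∫ ω, h (ω 0) ∂(iidLaw d α) = ∫ v, h v ∂(particleLaw d α) := by
    rw [← map_eval_iidLaw hd hα 0, integral_map (hmp 0).aemeasurable hm.aestronglyMeasurable]
  have := ProbabilityTheory.strong_law_ae_real (fun (i : ℕ) (ω : ℕ → Vel d) => h (ω i)) hint
    (fun i j hij => hind.indepFun hij) hident
  filter_upwards [this] with ω hω
  rw [hE] at hω
  refine hω.congr fun N => ?_
  rw [Finset.sum_range]

/-- The `N` first velocities of the independent sequence have the density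
`c⁻ᴺ exp (-∑ |v_i|^(2+α))` on configuration space. -/
theorem map_initialConf_iidLaw (hd : 1 ≤ d) (hα : -2 < α) (N : ℕ) :
    (iidLaw d α).map (initialConf d N) =
      ENNReal.ofReal ((constC d α)⁻¹ ^ N) •
        (volume : Measure (Conf d N)).withDensity
          (fun V => ENNReal.ofReal (Real.exp (-∑ i, ‖V i‖ ^ (2 + α)))) := by
  have hc := constC_pos hd hα
  have hto : Measurable (WithLp.toLp 2 : (Fin N → Vel d) → Conf d N) := by fun_prop
  have hof := PiLp.measurePreserving_ofLp_volume (ι := Fin N) (E := Vel d)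
  have hpi : (iidLaw d α).map (fun ω (i : Fin N) => ω i) =
      (volume : Measure (Fin N → Vel d)).withDensity fun v =>
        ENNReal.ofReal (∏ i, (Real.exp (-‖v i‖ ^ (2 + α)) / constC d α)) := by
    rw [map_restrict_iidLaw hd hα N]
    exact Measure.pi_withDensity_ofReal volume _ (fun v => by positivity)
      ((integrable_exp_neg_norm_rpow hd hα).div_const _)
  -- The law on the plain product space, carried over to the Euclidean norm by `WithLp.toLp`.
  have hcomp : initialConf d N = WithLp.toLp 2 ∘ fun ω (i : Fin N) => ω i := rfl
  rw [hcomp, ← Measure.map_map hto (by fun_prop), hpi]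
  ext s hs
  rw [Measure.map_apply hto hs, withDensity_apply _ (hto hs), Measure.smul_apply,
    withDensity_apply _ hs, smul_eq_mul, ← lintegral_const_mul _ (by fun_prop),
    ← hof.setLIntegral_comp_preimage (hto hs) (by fun_prop)]
  refine lintegral_congr fun V => ?_
  rw [← ENNReal.ofReal_mul (by positivity), Finset.prod_div_distrib, ← Real.exp_sum,
    Finset.sum_neg_distrib]
  congr 1
  simp only [Finset.prod_const, Finset.card_univ, Fintype.card_fin, inv_pow]
  rw [div_eq_inv_mul]

end IID

/-! ### Projection to the energy sphere -/

section Sphere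

variable {d : ℕ} {α : ℝ}

/-- The sum `∑ |v_i|^(2+α)` over the particles of a configuration. -/
noncomputable def powSum (α : ℝ) {d N : ℕ} (V : Conf d N) : ℝ := ∑ i, ‖V i‖ ^ (2 + α)

/-- The power mean `((1/N) ∑ |v_i|^(2+α))^(1/(2+α))` of the speeds in a configuration. -/
noncomputable def speedMean (α : ℝ) {d N : ℕ} (V : Conf d N) : ℝ :=
  (powSum α V / N) ^ (1 / (2 + α))

/-- The radial projection to the energy sphere of the first `N` velocities of a sequence. -/
noncomputable def sphereConf (d N : ℕ) (ω : ℕ → Vel d) : Conf d N :=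
  (√N / ‖initialConf d N ω‖) • initialConf d N ω

/-- The factor between the weight on the energy sphere and the power mean of the speeds under the
projected law of independent velocities. -/
noncomputable def weightFactor (d : ℕ) (α : ℝ) (N : ℕ) : ℝ :=
  (constC d α)⁻¹ ^ N * (Real.Gamma (d * N / (2 + α)) / (2 + α) * √N) *
    (N : ℝ) ^ (-(1 / (2 + α)))

theorem measurable_powSum {N : ℕ} : Measurable (powSum α : Conf d N → ℝ) := by
  unfold powSum
  fun_prop

theorem measurable_speedMean {N : ℕ} : Measurable (speedMean α : Conf d N → ℝ) := by
  unfold speedMean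
  have := measurable_powSum (d := d) (α := α) (N := N)
  fun_prop

theorem measurable_sphereConf (N : ℕ) : Measurable (sphereConf d N) := by
  unfold sphereConf
  have := measurable_initialConf (d := d) N
  fun_prop

theorem powSum_nonneg {N : ℕ} (V : Conf d N) : 0 ≤ powSum α V :=
  Finset.sum_nonneg fun _ _ => Real.rpow_nonneg (norm_nonneg _) _

theorem powSum_pos {N : ℕ} {V : Conf d N} (hV : V ≠ 0) : 0 < powSum α V := by
  have : ∃ i, V i ≠ 0 := by
    by_contra! h
    exact hV (by ext1 i; simpa using h i)
  obtain ⟨i, hi⟩ := this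
  exact Finset.sum_pos' (fun _ _ => Real.rpow_nonneg (norm_nonneg _) _)
    ⟨i, Finset.mem_univ i, Real.rpow_pos_of_pos (norm_pos_iff.mpr hi) _⟩

theorem powSum_smul {N : ℕ} {r : ℝ} (hr : 0 < r) (V : Conf d N) :
    powSum α (r • V) = r ^ (2 + α) * powSum α V := by
  simp only [powSum, Finset.mul_sum, PiLp.smul_apply, norm_smul, Real.norm_eq_abs, abs_of_pos hr]
  exact Finset.sum_congr rfl fun _ _ => Real.mul_rpow hr.le (norm_nonneg _)

theorem finrank_conf (d N : ℕ) : (Module.finrank ℝ (Conf d N) : ℝ) = d * N := by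
  have : Module.finrank ℝ (Conf d N) = N * d := by
    rw [(PiLp.continuousLinearEquiv 2 ℝ (fun _ : Fin N => Vel d)).toLinearEquiv.finrank_eq,
      Module.finrank_pi_fintype]
    simp
  rw [this]
  push_cast
  ring

theorem nontrivial_conf (hd : 1 ≤ d) {N : ℕ} (hN : 1 ≤ N) : Nontrivial (Conf d N) := by
  have h : (Module.finrank ℝ (Conf d N) : ℝ) ≠ 0 := by
    rw [finrank_conf]
    positivity
  exact Module.nontrivial_of_finrank_pos (R := ℝ) (Nat.pos_of_ne_zero (by exact_mod_cast h))

theorem ae_norm_eq_surfaceMeasure {E : Type*} [NormedAddCommGroup E] [InnerProductSpace ℝ E]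
    [FiniteDimensional ℝ E] [MeasurableSpace E] [BorelSpace E] {R : ℝ} (hR : 0 ≤ R) :
    ∀ᵐ V ∂(surfaceMeasure E R), ‖V‖ = R := by
  unfold surfaceMeasure
  refine Measure.ae_smul_measure ?_ _
  rw [ae_map_iff (by fun_prop) (measurableSet_eq_fun (by fun_prop) (by fun_prop))]
  refine Eventually.of_forall fun w => ?_
  rw [norm_smul, Real.norm_eq_abs, abs_of_nonneg hR, mem_sphere_zero_iff_norm.mp w.2, mul_one]

theorem ae_norm_eq_energySurface (N : ℕ) : ∀ᵐ V ∂(energySurface d N), ‖V‖ = √N :=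
  ae_norm_eq_surfaceMeasure (Real.sqrt_nonneg _)

theorem ae_ne_zero_energySurface {N : ℕ} (hN : 1 ≤ N) : ∀ᵐ V ∂(energySurface d N), V ≠ 0 := by
  filter_upwards [ae_norm_eq_energySurface N] with V hV
  rw [← norm_pos_iff, hV]
  positivity

/-- The radial projection of independent velocities has the density `∝ (∑ |v_i|^(2+α))^(-dN/(2+α))`
on the energy sphere. -/
theorem map_sphereConf_iidLaw (hd : 1 ≤ d) (hα : -2 < α) {N : ℕ} (hN : 1 ≤ N) :
    (iidLaw d α).map (sphereConf d N) =
      ENNReal.ofReal ((constC d α)⁻¹ ^ N *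
          (Real.Gamma (d * N / (2 + α)) / (2 + α) * √N)) •
        (energySurface d N).withDensity
          fun V => ENNReal.ofReal (powSum α V ^ (-((d : ℝ) * N / (2 + α)))) := by
  have hp : 0 < 2 + α := by linarith
  have hc := constC_pos hd hα
  have := nontrivial_conf hd hN
  have hpm := measurable_powSum (d := d) (α := α) (N := N)
  have hproj : Measurable fun V : Conf d N => (√N / ‖V‖) • V := by fun_prop
  have hcomp : sphereConf d N = (fun V : Conf d N => (√N / ‖V‖) • V) ∘ initialConf d N := rfl
  ext s hs
  have hH : Measurable (s.indicator (1 : Conf d N → ENNReal)) := measurable_one.indicator hs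
  have hHproj : Measurable fun V : Conf d N =>
      s.indicator (1 : Conf d N → ENNReal) ((√N / ‖V‖) • V) := hH.comp hproj
  have hexp : Measurable fun V : Conf d N =>
      ENNReal.ofReal (Real.exp (-∑ i, ‖V i‖ ^ (2 + α))) := by fun_prop
  have hpolar := lintegral_radial_exp_neg_homogeneous (E := Conf d N) hp
    (R := √N) (by positivity) hpm (fun x hx => powSum_pos hx) (fun r hr x => powSum_smul hr x) hH
  rw [finrank_conf] at hpolar
  rw [hcomp, ← Measure.map_map hproj (measurable_initialConf N), map_initialConf_iidLaw hd hα,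
    ← lintegral_indicator_one hs, lintegral_map hH hproj, lintegral_smul_measure,
    lintegral_withDensity_eq_lintegral_mul _ hexp hHproj,
    Measure.smul_apply, smul_eq_mul, smul_eq_mul, ENNReal.ofReal_mul (by positivity), mul_assoc,
    ← lintegral_indicator_one hs (μ := (energySurface d N).withDensity _),
    lintegral_withDensity_eq_lintegral_mul _ (by fun_prop) hH]
  congr 1
  simp only [Pi.mul_apply]
  simp_rw [mul_comm _ (s.indicator (1 : Conf d N → ENNReal) _)]
  exact hpolar

theorem weightFactor_pos (hd : 1 ≤ d) (hα : -2 < α) {N : ℕ} (hN : 1 ≤ N) :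
    0 < weightFactor d α N := by
  have hp : 0 < 2 + α := by linarith
  have hc := constC_pos hd hα
  have hG : 0 < Real.Gamma (d * N / (2 + α)) := Real.Gamma_pos_of_pos (by positivity)
  unfold weightFactor
  positivity

/-- The factor `speedMean` turns the exponent `-dN/(2+α)` of the projected independent velocities
into the exponent `-(dN-1)/(2+α)` of the stationary weight. -/
theorem weight_eq {N : ℕ} (hα : -2 < α) (hN : 1 ≤ N) {V : Conf d N} (hV : V ≠ 0) :
    powSum α V ^ (-((d : ℝ) * N / (2 + α))) * speedMean α V =
      (N : ℝ) ^ (-(1 / (2 + α))) * weight d α N V := by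
  have hp : 0 < 2 + α := by linarith
  have hS := powSum_pos (α := α) hV
  have hN' : (0 : ℝ) < N := by positivity
  rw [weight, ← powSum, speedMean, Real.div_rpow hS.le hN'.le, Real.rpow_neg hN'.le, one_div,
    one_div, ← Real.rpow_neg hS.le,
    show -(((d : ℝ) * N - 1) / (2 + α)) = -((d : ℝ) * N / (2 + α)) + (2 + α)⁻¹ by field_simp; ring,
    Real.rpow_add hS]
  field_simp

/-- `weight_eq` in the form in which it turns integrals against the density of
`map_sphereConf_iidLaw` into integrals against the stationary weight. -/
theorem ae_density_smul_eq (hα : -2 < α) {N : ℕ} (hN : 1 ≤ N) (φ : Conf d N → ℝ) :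
    (fun V => (ENNReal.ofReal (powSum α V ^ (-((d : ℝ) * N / (2 + α))))).toReal •
        (φ V * speedMean α V)) =ᵐ[energySurface d N]
      fun V => (N : ℝ) ^ (-(1 / (2 + α))) * (φ V * weight d α N V) := by
  filter_upwards [ae_ne_zero_energySurface hN] with V hV
  rw [ENNReal.toReal_ofReal (Real.rpow_nonneg (powSum_nonneg V) _), smul_eq_mul, mul_left_comm,
    weight_eq hα hN hV, mul_left_comm]

theorem integral_speedMean_iidLaw (hd : 1 ≤ d) (hα : -2 < α) {N : ℕ} (hN : 1 ≤ N)
    {φ : Conf d N → ℝ} (hφ : Measurable φ) :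
    ∫ ω, φ (sphereConf d N ω) * speedMean α (sphereConf d N ω) ∂(iidLaw d α) =
      weightFactor d α N * ∫ V, φ V * weight d α N V ∂(energySurface d N) := by
  have hp : 0 < 2 + α := by linarith
  have hc := constC_pos hd hα
  have hG : 0 < Real.Gamma (d * N / (2 + α)) := Real.Gamma_pos_of_pos (by positivity)
  have hpm := measurable_powSum (d := d) (α := α) (N := N)
  have hm := hφ.mul (measurable_speedMean (α := α))
  calc ∫ ω, φ (sphereConf d N ω) * speedMean α (sphereConf d N ω) ∂(iidLaw d α)
      = ∫ V, φ V * speedMean α V ∂((iidLaw d α).map (sphereConf d N)) :=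
        (integral_map (measurable_sphereConf N).aemeasurable hm.aestronglyMeasurable).symm
    _ = _ := by
      rw [map_sphereConf_iidLaw hd hα hN, integral_smul_measure,
        integral_withDensity_eq_integral_toReal_smul (by fun_prop)
          (Eventually.of_forall fun _ => ENNReal.ofReal_lt_top),
        integral_congr_ae (ae_density_smul_eq hα hN φ), integral_const_mul,
        ENNReal.toReal_ofReal (by positivity), smul_eq_mul, weightFactor, mul_assoc
          ((constC d α)⁻¹ ^ N * (Real.Gamma (d * N / (2 + α)) / (2 + α) * √N))]

theorem integrable_mul_weight (hd : 1 ≤ d) (hα : -2 < α) {N : ℕ} (hN : 1 ≤ N)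
    {φ : Conf d N → ℝ} (hφ : Measurable φ)
    (hi : Integrable (fun ω => φ (sphereConf d N ω) * speedMean α (sphereConf d N ω))
      (iidLaw d α)) :
    Integrable (fun V => φ V * weight d α N V) (energySurface d N) := by
  have hp : 0 < 2 + α := by linarith
  have hc := constC_pos hd hα
  have hG : 0 < Real.Gamma (d * N / (2 + α)) := Real.Gamma_pos_of_pos (by positivity)
  have hpm := measurable_powSum (d := d) (α := α) (N := N)
  have hm := hφ.mul (measurable_speedMean (α := α))
  have h1 : Integrable (fun V => φ V * speedMean α V) ((iidLaw d α).map (sphereConf d N)) :=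
    (integrable_map_measure hm.aestronglyMeasurable (measurable_sphereConf N).aemeasurable).mpr hi
  have hK : 0 < (constC d α)⁻¹ ^ N * (Real.Gamma (d * N / (2 + α)) / (2 + α) * √N) := by positivity
  rw [map_sphereConf_iidLaw hd hα hN, integrable_smul_measure (ENNReal.ofReal_pos.mpr hK).ne'
    ENNReal.ofReal_ne_top, integrable_withDensity_iff_integrable_smul' (by fun_prop)
    (Eventually.of_forall fun _ => ENNReal.ofReal_lt_top),
    integrable_congr (ae_density_smul_eq hα hN φ),
    integrable_const_mul_iff (IsUnit.mk0 _ (by positivity))] at h1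
  exact h1

end Sphere

/-! ### The power mean of the speeds on the energy sphere -/

section SpeedMean

variable {d : ℕ} {α : ℝ}

theorem speedMean_nonneg {N : ℕ} (V : Conf d N) : 0 ≤ speedMean α V :=
  Real.rpow_nonneg (div_nonneg (powSum_nonneg V) N.cast_nonneg) _

theorem norm_initialConf_sq (N : ℕ) (ω : ℕ → Vel d) :
    ‖initialConf d N ω‖ ^ 2 = ∑ i : Fin N, ‖ω i‖ ^ 2 := by
  rw [PiLp.norm_sq_eq_of_L2]
  rfl

theorem ae_initialConf_ne_zero (hd : 1 ≤ d) (hα : -2 < α) :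
    ∀ᵐ ω ∂(iidLaw d α), ∀ N, 1 ≤ N → initialConf d N ω ≠ 0 := by
  have : Nonempty (Fin d) := ⟨⟨0, hd⟩⟩
  have h0 : ∀ᵐ v ∂(particleLaw d α), v ≠ 0 :=
    particleLaw_absolutelyContinuous.ae_le (Measure.ae_ne volume 0)
  rw [← map_eval_iidLaw hd hα 0] at h0
  filter_upwards [ae_of_ae_map (measurable_pi_apply 0).aemeasurable h0] with ω hω N hN h
  exact hω (congrArg (fun V : Conf d N => V ⟨0, hN⟩) h)

theorem norm_sphereConf {N : ℕ} {ω : ℕ → Vel d} (h : initialConf d N ω ≠ 0) :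
    ‖sphereConf d N ω‖ = √N := by
  have := norm_pos_iff.mpr h
  rw [sphereConf, norm_smul, Real.norm_eq_abs, abs_of_nonneg (by positivity),
    div_mul_cancel₀ _ this.ne']

/-- On the energy sphere every speed is at most `√N`, hence so is every power mean. -/
theorem speedMean_le_sqrt (hα : -2 < α) {N : ℕ} (hN : 1 ≤ N) {V : Conf d N} (hV : ‖V‖ = √N) :
    speedMean α V ≤ √N := by
  have hp : 0 < 2 + α := by linarith
  have hN' : (0 : ℝ) < N := by positivity
  have hi : ∀ i, ‖V i‖ ^ (2 + α) ≤ (√N) ^ (2 + α) := fun i =>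
    Real.rpow_le_rpow (norm_nonneg _) (hV ▸ PiLp.norm_apply_le V i) hp.le
  have hsum : powSum α V ≤ N * (√N) ^ (2 + α) := by
    calc powSum α V ≤ ∑ _i : Fin N, (√N) ^ (2 + α) := Finset.sum_le_sum fun i _ => hi i
      _ = _ := by simp
  calc speedMean α V ≤ ((√N) ^ (2 + α)) ^ (1 / (2 + α)) := by
        refine Real.rpow_le_rpow (div_nonneg (powSum_nonneg V) hN'.le) ?_ (by positivity)
        rw [div_le_iff₀ hN']
        linarith
    _ = √N := by
        rw [← Real.rpow_mul (Real.sqrt_nonneg _), mul_one_div_cancel hp.ne', Real.rpow_one]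

theorem speedMean_sphereConf (hα : -2 < α) {N : ℕ} (hN : 1 ≤ N) {ω : ℕ → Vel d}
    (h : initialConf d N ω ≠ 0) :
    speedMean α (sphereConf d N ω) =
      ((∑ i : Fin N, ‖ω i‖ ^ (2 + α)) / N) ^ (1 / (2 + α)) /
        √((∑ i : Fin N, ‖ω i‖ ^ 2) / N) := by
  have hp : 0 < 2 + α := by linarith
  have hN' : (0 : ℝ) < N := by positivity
  have hx := norm_pos_iff.mpr h
  have hS : powSum α (initialConf d N ω) = ∑ i : Fin N, ‖ω i‖ ^ (2 + α) := rfl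
  have hS0 := powSum_nonneg (α := α) (initialConf d N ω)
  rw [speedMean, sphereConf, powSum_smul (by positivity), mul_div_assoc, ← hS,
    Real.mul_rpow (by positivity) (by positivity), ← Real.rpow_mul (by positivity),
    mul_one_div_cancel hp.ne', Real.rpow_one, ← norm_initialConf_sq, Real.sqrt_div (by positivity),
    Real.sqrt_sq hx.le]
  field_simp

end SpeedMean

end SteadyState

/-! ### Convergence in mean from bounded second moments -/

section UniformIntegrability

variable {Ω : Type*} [MeasurableSpace Ω] {P : Measure Ω} [IsProbabilityMeasure P]

/-- Almost sure convergence to zero with bounded second moments gives convergence in mean, because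
`|D| ≤ min |D| K + D² / K` for every `K > 0`. -/
theorem tendsto_integral_abs_of_ae_tendsto_zero {D : ℕ → Ω → ℝ} {C : ℝ}
    (hm : ∀ n, AEStronglyMeasurable (D n) P) (hsq : ∀ n, Integrable (fun ω => D n ω ^ 2) P)
    (hC : ∀ n, ∫ ω, D n ω ^ 2 ∂P ≤ C) (hlim : ∀ᵐ ω ∂P, Tendsto (fun n => D n ω) atTop (𝓝 0)) :
    Tendsto (fun n => ∫ ω, |D n ω| ∂P) atTop (𝓝 0) := by
  have hC0 : 0 ≤ C := (integral_nonneg fun ω => sq_nonneg (D 0 ω)).trans (hC 0)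
  rw [Metric.tendsto_atTop]
  intro δ hδ
  set K : ℝ := 2 * (C + 1) / δ with hK
  have hKpos : 0 < K := by positivity
  have hmin : ∀ n, AEStronglyMeasurable (fun ω => min |D n ω| K) P := fun n =>
    (hm n).norm.inf aestronglyMeasurable_const
  have hminbd : ∀ n ω, ‖min |D n ω| K‖ ≤ K := fun n ω => by
    rw [Real.norm_eq_abs, abs_of_nonneg (le_min (abs_nonneg _) hKpos.le)]
    exact min_le_right _ _
  have hminint : ∀ n, Integrable (fun ω => min |D n ω| K) P := fun n =>
    (integrable_const K).mono' (hmin n) (Eventually.of_forall (hminbd n))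
  have htrunc : Tendsto (fun n => ∫ ω, min |D n ω| K ∂P) atTop (𝓝 0) := by
    have := tendsto_integral_of_dominated_convergence (μ := P) (F := fun n ω => min |D n ω| K)
      (f := fun _ => 0) (fun _ => K) hmin (integrable_const K)
      (fun n => Eventually.of_forall (hminbd n)) (by
        filter_upwards [hlim] with ω hω
        have h := (hω.abs).min (tendsto_const_nhds (x := K))
        rwa [abs_zero, min_eq_left hKpos.le] at h)
    simpa using this
  obtain ⟨n₀, hn₀⟩ := (Metric.tendsto_atTop.mp htrunc) (δ / 2) (by positivity)
  refine ⟨n₀, fun n hn => ?_⟩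
  have h1 := hn₀ n hn
  rw [Real.dist_eq, sub_zero] at h1 ⊢
  -- With `K` as chosen, the tail contributes at most `C / K < δ / 2`.
  have h2 : ∫ ω, |D n ω| ∂P ≤ ∫ ω, (min |D n ω| K + D n ω ^ 2 / K) ∂P := by
    refine integral_mono_of_nonneg (Eventually.of_forall fun _ => abs_nonneg _)
      ((hminint n).add ((hsq n).div_const K)) (Eventually.of_forall fun ω => ?_)
    simp only
    rcases le_total |D n ω| K with h | h
    · rw [min_eq_left h]
      have : 0 ≤ D n ω ^ 2 / K := by positivity
      linarith
    · rw [min_eq_right h]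
      have : |D n ω| ≤ D n ω ^ 2 / K := by
        rw [le_div_iff₀ hKpos, ← sq_abs]
        nlinarith [abs_nonneg (D n ω)]
      linarith
  rw [integral_add (hminint n) ((hsq n).div_const K), integral_div] at h2
  have h3 : (∫ ω, D n ω ^ 2 ∂P) / K < δ / 2 := by
    rw [div_lt_iff₀ hKpos, hK]
    have : δ / 2 * (2 * (C + 1) / δ) = C + 1 := by field_simp
    linarith [hC n]
  rw [abs_of_nonneg (integral_nonneg fun _ => abs_nonneg _)]
  linarith [le_abs_self (∫ ω, min |D n ω| K ∂P)]

theorem tendsto_integral_of_ae_tendsto_of_sq_le {Z : ℕ → Ω → ℝ} {Z' : Ω → ℝ} {C b : ℝ}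
    (hm : ∀ n, AEStronglyMeasurable (Z n) P) (hm' : AEStronglyMeasurable Z' P)
    (hsq : ∀ n, Integrable (fun ω => Z n ω ^ 2) P)
    (hC : ∀ n, ∫ ω, Z n ω ^ 2 ∂P ≤ C) (hb : ∀ ω, |Z' ω| ≤ b)
    (hlim : ∀ᵐ ω ∂P, Tendsto (fun n => Z n ω) atTop (𝓝 (Z' ω))) :
    Tendsto (fun n => ∫ ω, Z n ω ∂P) atTop (𝓝 (∫ ω, Z' ω ∂P)) := by
  have hZ' : Integrable Z' P :=
    (integrable_const b).mono' hm' (Eventually.of_forall hb)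
  have hZ : ∀ n, Integrable (Z n) P := fun n =>
    ((memLp_two_iff_integrable_sq (hm n)).mpr (hsq n)).integrable (by norm_num)
  have hle : ∀ n ω, (Z n ω - Z' ω) ^ 2 ≤ 2 * Z n ω ^ 2 + 2 * b ^ 2 := fun n ω => by
    have h1 : Z' ω ^ 2 ≤ b ^ 2 := sq_le_sq' (by linarith [neg_abs_le (Z' ω), hb ω])
      ((le_abs_self _).trans (hb ω))
    nlinarith [sq_nonneg (Z n ω + Z' ω)]
  have hdom : ∀ n, Integrable (fun ω => 2 * Z n ω ^ 2 + 2 * b ^ 2) P := fun n =>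
    ((hsq n).const_mul 2).add (integrable_const _)
  have hDm : ∀ n, AEStronglyMeasurable (fun ω => Z n ω - Z' ω) P := fun n => (hm n).sub hm'
  have hDsq : ∀ n, Integrable (fun ω => (Z n ω - Z' ω) ^ 2) P := fun n =>
    (hdom n).mono' ((hDm n).pow 2) (Eventually.of_forall fun ω => by
      rw [Real.norm_eq_abs, abs_of_nonneg (sq_nonneg _)]
      exact hle n ω)
  have key := tendsto_integral_abs_of_ae_tendsto_zero (P := P) (D := fun n ω => Z n ω - Z' ω)
    (C := 2 * C + 2 * b ^ 2) hDm hDsq (fun n => by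
      refine (integral_mono (hDsq n) (hdom n) (hle n)).trans ?_
      rw [integral_add ((hsq n).const_mul 2) (integrable_const _), integral_const_mul]
      simp only [integral_const, probReal_univ, one_smul]
      linarith [hC n]) (by
      filter_upwards [hlim] with ω hω
      simpa using hω.sub_const (Z' ω))
  rw [tendsto_iff_norm_sub_tendsto_zero]
  refine squeeze_zero (fun _ => norm_nonneg _) (fun n => ?_) key
  rw [← integral_sub (hZ n) hZ']
  exact norm_integral_le_integral_norm _

end UniformIntegrability

namespace SteadyState

/-! ### Law of large numbers and moment bounds -/

section Limits

variable {d : ℕ} {α : ℝ}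

/-- The limit of the power mean of the speeds on the energy sphere. -/
noncomputable def limitSpeedMean (d : ℕ) (α : ℝ) : ℝ :=
  ((d : ℝ) / (2 + α)) ^ (1 / (2 + α)) / √(constMu d α)

theorem limitSpeedMean_pos (hd : 1 ≤ d) (hα : -2 < α) : 0 < limitSpeedMean d α := by
  have hp : 0 < 2 + α := by linarith
  have := constMu_pos hd hα
  unfold limitSpeedMean
  positivity

theorem ae_tendsto_norm_sq_average (hd : 1 ≤ d) (hα : -2 < α) :
    ∀ᵐ ω ∂(iidLaw d α), Tendsto (fun N : ℕ => (∑ i : Fin N, ‖ω i‖ ^ 2) / N) atTop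
      (𝓝 (constMu d α)) := by
  rw [← integral_norm_sq_particleLaw hd hα]
  exact ae_tendsto_average_iidLaw hd hα (by fun_prop) (integrable_norm_sq_particleLaw hd hα)

theorem ae_tendsto_speedMean (hd : 1 ≤ d) (hα : -2 < α) :
    ∀ᵐ ω ∂(iidLaw d α), Tendsto (fun N : ℕ => speedMean α (sphereConf d N ω)) atTop
      (𝓝 (limitSpeedMean d α)) := by
  have hp : 0 < 2 + α := by linarith
  have hμ := constMu_pos hd hα
  have hpow := ae_tendsto_average_iidLaw hd hα (h := fun v => ‖v‖ ^ (2 + α)) (by fun_prop)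
    (integrable_norm_rpow_particleLaw hd hα hp.le)
  rw [integral_norm_rpow_particleLaw hd hα] at hpow
  filter_upwards [hpow, ae_tendsto_norm_sq_average hd hα, ae_initialConf_ne_zero hd hα]
    with ω h1 h2 h3
  have hlim := (h1.rpow_const (p := 1 / (2 + α)) (Or.inl (by positivity))).div h2.sqrt
    (Real.sqrt_pos.mpr hμ).ne'
  refine hlim.congr' ?_
  filter_upwards [eventually_ge_atTop 1] with N hN
  exact (speedMean_sphereConf hα hN (h3 N hN)).symm

theorem ae_tendsto_sphereConf (hd : 1 ≤ d) (hα : -2 < α) :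
    ∀ᵐ ω ∂(iidLaw d α), ∀ i : ℕ, Tendsto (fun N : ℕ => (√N / ‖initialConf d N ω‖) • ω i) atTop
      (𝓝 ((√(constMu d α))⁻¹ • ω i)) := by
  have hμ := constMu_pos hd hα
  filter_upwards [ae_tendsto_norm_sq_average hd hα] with ω h2 i
  have hlim := (h2.sqrt.inv₀ (Real.sqrt_pos.mpr hμ).ne').smul_const (ω i)
  refine hlim.congr fun N => ?_
  rw [← norm_initialConf_sq, Real.sqrt_div (by positivity), Real.sqrt_sq (norm_nonneg _), inv_div]

theorem ae_speedMean_le_sqrt (hd : 1 ≤ d) (hα : -2 < α) :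
    ∀ᵐ ω ∂(iidLaw d α), ∀ N : ℕ, speedMean α (sphereConf d N ω) ≤ √N := by
  have hp : 0 < 2 + α := by linarith
  filter_upwards [ae_initialConf_ne_zero hd hα] with ω hω N
  rcases Nat.eq_zero_or_pos N with rfl | hN
  · simp [speedMean, hp.ne']
  · exact speedMean_le_sqrt hα hN (norm_sphereConf (hω N hN))

theorem integrable_eval_iidLaw (hd : 1 ≤ d) (hα : -2 < α) {h : Vel d → ℝ}
    (hi : Integrable h (particleLaw d α)) (i : ℕ) :
    Integrable (fun ω => h (ω i)) (iidLaw d α) := by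
  rw [← map_eval_iidLaw hd hα i] at hi
  exact hi.comp_measurable (measurable_pi_apply i)

theorem integral_eval_iidLaw (hd : 1 ≤ d) (hα : -2 < α) {h : Vel d → ℝ} (hm : Measurable h)
    (i : ℕ) : ∫ ω, h (ω i) ∂(iidLaw d α) = ∫ v, h v ∂(particleLaw d α) := by
  rw [← map_eval_iidLaw hd hα i, integral_map (measurable_pi_apply i).aemeasurable
    hm.aestronglyMeasurable]

theorem integrable_prod_iidLaw (hd : 1 ≤ d) (hα : -2 < α) {h : Vel d → ℝ}
    (hi : Integrable h (particleLaw d α)) (N : ℕ) :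
    Integrable (fun ω => ∏ i : Fin N, h (ω i)) (iidLaw d α) := by
  have := isProbabilityMeasure_particleLaw hd hα
  have h1 : Integrable (fun v : Fin N → Vel d => ∏ i, h (v i))
      (Measure.pi fun _ => particleLaw d α) := Integrable.fintype_prod fun _ => hi
  rw [← map_restrict_iidLaw hd hα N] at h1
  exact h1.comp_measurable (by fun_prop)

theorem integral_prod_iidLaw (hd : 1 ≤ d) (hα : -2 < α) {h : Vel d → ℝ} (hm : Measurable h)
    (N : ℕ) : ∫ ω, ∏ i : Fin N, h (ω i) ∂(iidLaw d α) = (∫ v, h v ∂(particleLaw d α)) ^ N := by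
  have := isProbabilityMeasure_particleLaw hd hα
  have h1 := integral_fintype_prod_eq_pow (ι := Fin N) (μ := particleLaw d α) h
  rw [Fintype.card_fin] at h1
  rw [← h1, ← map_restrict_iidLaw hd hα N, integral_map (Measurable.aemeasurable (by fun_prop))
    (Measurable.aestronglyMeasurable (by fun_prop))]

/-- A power of order `s` of the mean of nonnegative numbers, bounded through the mean of their
`m`-th powers for an integer `m ≥ s`. -/
theorem average_rpow_le_one_add_average_pow {N : ℕ} (hN : 1 ≤ N) {a : Fin N → ℝ}
    (ha : ∀ i, 0 ≤ a i) {s : ℝ} (hs : 0 ≤ s) {m : ℕ} (hm : s ≤ m) :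
    ((∑ i, a i) / N) ^ s ≤ 1 + (∑ i, a i ^ m) / N := by
  have hN' : (0 : ℝ) < N := by positivity
  have hA : 0 ≤ (∑ i, a i) / N := div_nonneg (Finset.sum_nonneg fun i _ => ha i) hN'.le
  have hM : 0 ≤ (∑ i, a i ^ m) / N :=
    div_nonneg (Finset.sum_nonneg fun i _ => pow_nonneg (ha i) m) hN'.le
  rcases le_total ((∑ i, a i) / N) 1 with h | h
  · linarith [Real.rpow_le_one hA h hs]
  · have h1 : ((∑ i, a i) / N) ^ s ≤ ((∑ i, a i) / N) ^ m := by
      rw [← Real.rpow_natCast]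
      exact Real.rpow_le_rpow_of_exponent_le h hm
    have h2 := Real.pow_arith_mean_le_arith_mean_pow Finset.univ (fun _ : Fin N => (N : ℝ)⁻¹) a
      (fun _ _ => by positivity) (by simp [hN'.ne']) (fun i _ => ha i) m
    rw [← Finset.mul_sum, ← Finset.mul_sum, ← div_eq_inv_mul, ← div_eq_inv_mul] at h2
    linarith

/-- The power mean of the speeds has bounded fourth moments. When the mean energy of the independent
velocities is at least `ε`, the fourth power is controlled by their moments; the complementary event
has exponentially small probability, and there the bound `√N` suffices. -/
theorem exists_integral_speedMean_pow_four_le (hd : 1 ≤ d) (hα : -2 < α) :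
    ∃ C : ℝ, ∀ N : ℕ, ∫ ω, speedMean α (sphereConf d N ω) ^ 4 ∂(iidLaw d α) ≤ C := by
  have hp : 0 < 2 + α := by linarith
  have hprob := isProbabilityMeasure_particleLaw hd hα
  have hprob' := isProbabilityMeasure_iidLaw hd hα
  set q := ∫ v, Real.exp (-‖v‖ ^ 2) ∂(particleLaw d α) with hq
  have hq1 : q < 1 := integral_exp_neg_norm_sq_particleLaw_lt_one hd hα
  have hq0 : 0 < q := integral_exp_pos (integrable_exp_neg_norm_sq_particleLaw hd hα)
  -- With this `ε` the Chernoff factor `exp ε * q` equals `√q < 1`.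
  set ε := -Real.log q / 2 with hε
  have hεpos : 0 < ε := by
    have := Real.log_neg hq0 hq1
    linarith
  have hfac : Real.exp ε * q < 1 := by
    rw [← Real.exp_log hq0, ← Real.exp_add, Real.exp_lt_one_iff]
    have := Real.log_neg hq0 hq1
    linarith
  have hfac0 : 0 < Real.exp ε * q := by positivity
  obtain ⟨m, hm⟩ := exists_nat_ge (4 / (2 + α))
  have hmom := integrable_norm_rpow_particleLaw hd hα (s := (2 + α) * m) (by positivity)
  set M := ∫ v, ‖v‖ ^ ((2 + α) * m) ∂(particleLaw d α) with hM
  have hgeom : Tendsto (fun N : ℕ => (N : ℝ) ^ 2 * (Real.exp ε * q) ^ N) atTop (𝓝 0) :=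
    tendsto_pow_const_mul_const_pow_of_abs_lt_one 2 (by rwa [abs_of_pos hfac0])
  obtain ⟨C₁, hC₁⟩ := hgeom.bddAbove_range
  have hh : Integrable (fun v : Vel d => Real.exp (ε - ‖v‖ ^ 2)) (particleLaw d α) := by
    simpa only [sub_eq_add_neg, Real.exp_add] using
      (integrable_exp_neg_norm_sq_particleLaw hd hα).const_mul (Real.exp ε)
  have hhint : ∫ v, Real.exp (ε - ‖v‖ ^ 2) ∂(particleLaw d α) = Real.exp ε * q := by
    rw [hq, ← integral_const_mul]
    simp only [sub_eq_add_neg, Real.exp_add]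
  refine ⟨max 0 (C₁ + (1 + M) / ε ^ 2), fun N => ?_⟩
  rcases Nat.eq_zero_or_pos N with rfl | hN
  · simp [speedMean, hp.ne']
  refine le_max_of_le_right ?_
  have hN' : (0 : ℝ) < N := by positivity
  have hi1 : Integrable (fun ω : ℕ → Vel d => (N : ℝ) ^ 2 *
      ∏ i : Fin N, Real.exp (ε - ‖ω i‖ ^ 2)) (iidLaw d α) :=
    (integrable_prod_iidLaw hd hα hh N).const_mul _
  have hi4 : ∀ i : Fin N, Integrable (fun ω : ℕ → Vel d => ‖ω i‖ ^ ((2 + α) * m)) (iidLaw d α) :=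
    fun i => integrable_eval_iidLaw hd hα hmom i
  have hi2 : Integrable (fun ω : ℕ → Vel d => ∑ i : Fin N, ‖ω i‖ ^ ((2 + α) * m)) (iidLaw d α) :=
    integrable_finsetSum _ fun i _ => hi4 i
  have hi3 : Integrable (fun ω : ℕ → Vel d =>
      (1 + (∑ i : Fin N, ‖ω i‖ ^ ((2 + α) * m)) / N) / ε ^ 2) (iidLaw d α) :=
    ((integrable_const 1).add (hi2.div_const _)).div_const _
  have hpoint : ∀ᵐ ω ∂(iidLaw d α), speedMean α (sphereConf d N ω) ^ 4 ≤
      (N : ℝ) ^ 2 * ∏ i : Fin N, Real.exp (ε - ‖ω i‖ ^ 2) +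
        (1 + (∑ i : Fin N, ‖ω i‖ ^ ((2 + α) * m)) / N) / ε ^ 2 := by
    filter_upwards [ae_initialConf_ne_zero hd hα, ae_speedMean_le_sqrt hd hα] with ω hω hle
    have hsum0 : 0 ≤ ∑ i : Fin N, ‖ω i‖ ^ ((2 + α) * m) :=
      Finset.sum_nonneg fun _ _ => Real.rpow_nonneg (norm_nonneg _) _
    rcases lt_or_ge ((∑ i : Fin N, ‖ω i‖ ^ 2) / N) ε with hB | hB
    · -- Mean energy below `ε`: the product of exponentials dominates the indicator function.
      have h4 : speedMean α (sphereConf d N ω) ^ 4 ≤ (N : ℝ) ^ 2 := by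
        calc speedMean α (sphereConf d N ω) ^ 4 ≤ (√N) ^ 4 :=
              pow_le_pow_left₀ (speedMean_nonneg _) (hle N) 4
          _ = ((√N) ^ 2) ^ 2 := by ring
          _ = (N : ℝ) ^ 2 := by rw [Real.sq_sqrt hN'.le]
      have h5 : 1 ≤ ∏ i : Fin N, Real.exp (ε - ‖ω i‖ ^ 2) := by
        rw [← Real.exp_sum, Real.one_le_exp_iff, Finset.sum_sub_distrib]
        rw [div_lt_iff₀ hN'] at hB
        simp
        linarith
      have h6 : 0 ≤ (1 + (∑ i : Fin N, ‖ω i‖ ^ ((2 + α) * m)) / N) / ε ^ 2 := by positivity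
      nlinarith [sq_nonneg (N : ℝ)]
    · have hA0 : 0 ≤ (∑ i : Fin N, ‖ω i‖ ^ (2 + α)) / N :=
        div_nonneg (Finset.sum_nonneg fun _ _ => Real.rpow_nonneg (norm_nonneg _) _) hN'.le
      have hB0 : 0 < (∑ i : Fin N, ‖ω i‖ ^ 2) / N := hεpos.trans_le hB
      have h4 : speedMean α (sphereConf d N ω) ^ 4 =
          ((∑ i : Fin N, ‖ω i‖ ^ (2 + α)) / N) ^ (4 / (2 + α)) /
            ((∑ i : Fin N, ‖ω i‖ ^ 2) / N) ^ 2 := by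
        rw [speedMean_sphereConf hα hN (hω N hN), div_pow, ← Real.rpow_natCast,
          ← Real.rpow_mul hA0]
        congr 1
        · congr 1
          push_cast
          ring
        · rw [show (4 : ℕ) = 2 * 2 by norm_num, pow_mul, Real.sq_sqrt hB0.le]
      have h5 := average_rpow_le_one_add_average_pow hN
        (a := fun i : Fin N => ‖ω i‖ ^ (2 + α)) (fun _ => Real.rpow_nonneg (norm_nonneg _) _)
        (s := 4 / (2 + α)) (by positivity) hm
      simp only [← Real.rpow_mul_natCast (norm_nonneg _)] at h5
      have h6 : 0 ≤ (N : ℝ) ^ 2 * ∏ i : Fin N, Real.exp (ε - ‖ω i‖ ^ 2) := by positivity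
      rw [h4]
      have h7 : ((∑ i : Fin N, ‖ω i‖ ^ (2 + α)) / N) ^ (4 / (2 + α)) /
            ((∑ i : Fin N, ‖ω i‖ ^ 2) / N) ^ 2 ≤
          (1 + (∑ i : Fin N, ‖ω i‖ ^ ((2 + α) * m)) / N) / ε ^ 2 := by
        gcongr
      linarith
  have hbound := integral_mono_of_nonneg
    (Eventually.of_forall fun ω => pow_nonneg (speedMean_nonneg _) 4) (hi1.add hi3) hpoint
  refine hbound.trans ?_
  simp only [Pi.add_apply]
  rw [integral_add hi1 hi3, integral_const_mul,
    integral_prod_iidLaw hd hα (h := fun v => Real.exp (ε - ‖v‖ ^ 2)) (by fun_prop), hhint,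
    integral_div, integral_add (integrable_const _) (hi2.div_const _), integral_div,
    integral_finsetSum _ fun i _ => hi4 i]
  simp_rw [integral_eval_iidLaw hd hα (h := fun v => ‖v‖ ^ ((2 + α) * m)) (by fun_prop)]
  rw [← hM]
  have hMM : (∑ _i : Fin N, M) / N = M := by
    simp [hN'.ne']
  simp only [integral_const, probReal_univ, one_smul]
  rw [hMM]
  have := hC₁ (Set.mem_range_self N)
  linarith

theorem integrable_speedMean_pow (hd : 1 ≤ d) (hα : -2 < α) (N k : ℕ) :
    Integrable (fun ω => speedMean α (sphereConf d N ω) ^ k) (iidLaw d α) := by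
  have hprob' := isProbabilityMeasure_iidLaw hd hα
  refine (integrable_const ((√N) ^ k)).mono'
    (((measurable_speedMean.comp (measurable_sphereConf N)).pow_const k).aestronglyMeasurable) ?_
  filter_upwards [ae_speedMean_le_sqrt hd hα] with ω hω
  rw [Real.norm_eq_abs, abs_of_nonneg (pow_nonneg (speedMean_nonneg _) _)]
  exact pow_le_pow_left₀ (speedMean_nonneg _) (hω N) k

/-- Averages of bounded, almost surely convergent observables, weighted by a function of at most
quadratic growth of the power mean of the speeds. -/
theorem tendsto_integral_mul_speedMean (hd : 1 ≤ d) (hα : -2 < α) {u : ℕ → ℕ}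
    (hu : Tendsto u atTop atTop) {ψ : ℕ → (ℕ → Vel d) → ℝ} {ψ' : (ℕ → Vel d) → ℝ} {b : ℝ}
    (hψm : ∀ n, Measurable (ψ n)) (hψm' : Measurable ψ') (hb : ∀ n ω, |ψ n ω| ≤ b)
    (hb' : ∀ ω, |ψ' ω| ≤ b)
    (hψ : ∀ᵐ ω ∂(iidLaw d α), Tendsto (fun n => ψ n ω) atTop (𝓝 (ψ' ω)))
    {h : ℝ → ℝ} (hm : Measurable h) (hh : ∀ r, 0 ≤ r → |h r| ≤ 1 + r ^ 2)
    (hcont : ContinuousAt h (limitSpeedMean d α)) :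
    Tendsto (fun n => ∫ ω, ψ n ω * h (speedMean α (sphereConf d (u n) ω)) ∂(iidLaw d α)) atTop
      (𝓝 ((∫ ω, ψ' ω ∂(iidLaw d α)) * h (limitSpeedMean d α))) := by
  have hprob' := isProbabilityMeasure_iidLaw hd hα
  obtain ⟨C, hC⟩ := exists_integral_speedMean_pow_four_le hd hα
  have hRm : ∀ N, Measurable fun ω => speedMean α (sphereConf d N ω) := fun N =>
    measurable_speedMean.comp (measurable_sphereConf N)
  have hZm : ∀ n, Measurable fun ω => ψ n ω * h (speedMean α (sphereConf d (u n) ω)) := fun n =>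
    (hψm n).mul (hm.comp (hRm _))
  have hle : ∀ n ω, (ψ n ω * h (speedMean α (sphereConf d (u n) ω))) ^ 2 ≤
      b ^ 2 * (2 + 2 * speedMean α (sphereConf d (u n) ω) ^ 4) := fun n ω => by
    rw [mul_pow]
    have h1 : ψ n ω ^ 2 ≤ b ^ 2 := by
      rw [← sq_abs]
      exact pow_le_pow_left₀ (abs_nonneg _) (hb n ω) 2
    have h2 := hh _ (speedMean_nonneg (α := α) (sphereConf d (u n) ω))
    have h3 : h (speedMean α (sphereConf d (u n) ω)) ^ 2 ≤
        2 + 2 * speedMean α (sphereConf d (u n) ω) ^ 4 := by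
      rw [← sq_abs]
      refine (pow_le_pow_left₀ (abs_nonneg _) h2 2).trans ?_
      nlinarith [sq_nonneg (1 - speedMean α (sphereConf d (u n) ω) ^ 2)]
    gcongr
  have hdom : ∀ n, Integrable
      (fun ω => b ^ 2 * (2 + 2 * speedMean α (sphereConf d (u n) ω) ^ 4)) (iidLaw d α) := fun n =>
    (((integrable_const 2).add ((integrable_speedMean_pow hd hα (u n) 4).const_mul 2))).const_mul _
  have hsq : ∀ n, Integrable
      (fun ω => (ψ n ω * h (speedMean α (sphereConf d (u n) ω))) ^ 2) (iidLaw d α) := fun n =>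
    (hdom n).mono' ((hZm n).pow_const 2).aestronglyMeasurable (Eventually.of_forall fun ω => by
      rw [Real.norm_eq_abs, abs_of_nonneg (sq_nonneg _)]
      exact hle n ω)
  rw [← integral_mul_const]
  refine tendsto_integral_of_ae_tendsto_of_sq_le (C := b ^ 2 * (2 + 2 * C))
    (b := b * |h (limitSpeedMean d α)|) (fun n => (hZm n).aestronglyMeasurable)
    (hψm'.mul_const _).aestronglyMeasurable hsq (fun n => ?_) (fun ω => ?_) ?_
  · refine (integral_mono (hsq n) (hdom n) (hle n)).trans ?_
    rw [integral_const_mul, integral_add (integrable_const _)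
      ((integrable_speedMean_pow hd hα (u n) 4).const_mul 2), integral_const_mul]
    simp only [integral_const, probReal_univ, one_smul]
    have := hC (u n)
    gcongr
  · rw [abs_mul]
    exact mul_le_mul_of_nonneg_right (hb' ω) (abs_nonneg _)
  · filter_upwards [hψ, ae_tendsto_speedMean hd hα] with ω h1 h2
    exact h1.mul ((hcont.tendsto.comp h2).comp hu)

end Limits

end SteadyState

/-! ### Leading order of Stirling's formula for the Gamma function -/

section Gamma

/-- The bound comes from splitting `exp (-t) = exp (-θ t) * exp (-(1 - θ) t)` in the Gamma integral,
with `θ = 1 - 1 / x`, and maximizing `t ^ x * exp (-θ t)`. -/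
theorem Real.log_Gamma_le {x : ℝ} (hx : 2 ≤ x) :
    Real.log (Real.Gamma x) ≤ x * Real.log x - x + 2 := by
  have hx0 : 0 < x := by linarith
  have hθ : 0 < 1 - 1 / x := by
    rw [sub_pos, div_lt_one hx0]
    linarith
  set θ := 1 - 1 / x with hθdef
  have hr : 0 < 1 / x := by positivity
  have hle : ∀ t ∈ Set.Ioi (0 : ℝ), Real.exp (-t) * t ^ (x + 1 - 1) ≤
      Real.exp (x * Real.log (x / θ) - x) * (t ^ ((1 : ℝ) - 1) * Real.exp (-(1 / x * t))) := by
    intro t ht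
    have ht0 : (0 : ℝ) < t := ht
    rw [add_sub_cancel_right, sub_self, Real.rpow_zero, one_mul, Real.rpow_def_of_pos ht0,
      ← Real.exp_add, ← Real.exp_add, Real.exp_le_exp]
    -- The tangent line of the logarithm at `x / θ`, where `t ^ x * exp (-θ t)` is largest.
    have h1 : Real.log (θ * t / x) ≤ θ * t / x - 1 := Real.log_le_sub_one_of_pos (by positivity)
    have h2 : Real.log t = Real.log (θ * t / x) + Real.log (x / θ) := by
      rw [← Real.log_mul (by positivity) (by positivity)]
      congr 1
      field_simp
    have h3 : Real.log t * x ≤ (θ * t / x - 1 + Real.log (x / θ)) * x := by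
      rw [h2]
      gcongr
    have h4 : (θ * t / x - 1 + Real.log (x / θ)) * x = θ * t - x + x * Real.log (x / θ) := by
      field_simp
    have h5 : θ * t = t - 1 / x * t := by rw [hθdef]; ring
    linarith
  have hint : IntegrableOn (fun t : ℝ => t ^ ((1 : ℝ) - 1) * Real.exp (-(1 / x * t)))
      (Set.Ioi 0) := by
    simpa using integrableOn_exp_mul_Ioi (a := -(1 / x)) (by linarith) 0
  have hΓ : Real.Gamma (x + 1) ≤ Real.exp (x * Real.log (x / θ) - x) * x := by
    rw [Real.Gamma_eq_integral (by linarith)]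
    refine (setIntegral_mono_on (Real.GammaIntegral_convergent (by linarith))
      (hint.const_mul _) measurableSet_Ioi hle).trans ?_
    rw [integral_const_mul, Real.integral_rpow_mul_exp_neg_mul_Ioi one_pos hr]
    simp
  have hG : 0 < Real.Gamma x := Real.Gamma_pos_of_pos hx0
  rw [Real.Gamma_add_one hx0.ne', mul_comm] at hΓ
  have hΓ' := Real.log_le_log hG (le_of_mul_le_mul_right hΓ hx0)
  rw [Real.log_exp, Real.log_div hx0.ne' hθ.ne'] at hΓ'
  have h6 : -(x * Real.log θ) ≤ 2 := by
    have h7 : Real.log θ⁻¹ ≤ θ⁻¹ - 1 := Real.log_le_sub_one_of_pos (by positivity)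
    rw [Real.log_inv] at h7
    have h8 : x * (θ⁻¹ - 1) ≤ 2 := by
      have h9 : x - 1 ≠ 0 := by linarith
      have : x * (θ⁻¹ - 1) = x / (x - 1) := by
        rw [hθdef, one_sub_div hx0.ne', inv_div]
        field_simp
        ring
      rw [this, div_le_iff₀ (by linarith)]
      linarith
    nlinarith
  linarith

/-- The bound comes from restricting the integral for `Gamma (x + 1)` to the interval
`(x, x + 1]`. -/
theorem Real.le_log_Gamma {x : ℝ} (hx : 0 < x) :
    x * Real.log x - x - 1 - Real.log x ≤ Real.log (Real.Gamma x) := by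
  have hG : 0 < Real.Gamma x := Real.Gamma_pos_of_pos hx
  have hconv := Real.GammaIntegral_convergent (s := x + 1) (by linarith)
  have hsub : Set.Ioc x (x + 1) ⊆ Set.Ioi 0 := fun t ht => hx.trans ht.1
  have hΓ : Real.exp (-(x + 1)) * x ^ x ≤ Real.Gamma (x + 1) := by
    rw [Real.Gamma_eq_integral (by linarith)]
    calc Real.exp (-(x + 1)) * x ^ x
        = (Real.exp (-(x + 1)) * x ^ x) * (volume : Measure ℝ).real (Set.Ioc x (x + 1)) := by simp
      _ ≤ ∫ t in Set.Ioc x (x + 1), Real.exp (-t) * t ^ (x + 1 - 1) := by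
          refine setIntegral_ge_of_const_le_real measurableSet_Ioc (by simp) (fun t ht => ?_)
            (hconv.mono_set hsub)
          have : x ≤ t := ht.1.le
          rw [add_sub_cancel_right]
          gcongr
          exact ht.2
      _ ≤ ∫ t in Set.Ioi 0, Real.exp (-t) * t ^ (x + 1 - 1) := by
          refine setIntegral_mono_set hconv ?_ (Eventually.of_forall hsub)
          filter_upwards [ae_restrict_mem measurableSet_Ioi] with t ht
          have ht' : (0 : ℝ) < t := ht
          exact mul_nonneg (Real.exp_pos _).le (Real.rpow_nonneg ht'.le _)
  have := Real.log_le_log (by positivity) hΓ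
  rw [Real.Gamma_add_one hx.ne', Real.log_mul hx.ne' hG.ne', Real.log_mul (by positivity)
    (by positivity), Real.log_exp, Real.log_rpow hx] at this
  linarith

theorem tendsto_log_natCast_div : Tendsto (fun N : ℕ => Real.log N / N) atTop (𝓝 0) := by
  have := (Real.isLittleO_log_id_atTop.tendsto_div_nhds_zero).comp tendsto_natCast_atTop_atTop
  exact this

/-- The leading order of Stirling's formula along a progression `a N`. -/
theorem tendsto_log_Gamma_mul_natCast {a : ℝ} (ha : 0 < a) :
    Tendsto (fun N : ℕ => (Real.log (Real.Gamma (a * N)) -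
      (a * N * Real.log (a * N) - a * N)) / N) atTop (𝓝 0) := by
  have hinv : Tendsto (fun N : ℕ => ((N : ℝ))⁻¹) atTop (𝓝 0) := tendsto_inv_atTop_nhds_zero_nat
  have hlow : Tendsto (fun N : ℕ => -(1 + Real.log a) * (N : ℝ)⁻¹ - Real.log N / N) atTop
      (𝓝 0) := by
    simpa using (hinv.const_mul (-(1 + Real.log a))).sub tendsto_log_natCast_div
  have hup : Tendsto (fun N : ℕ => 2 * (N : ℝ)⁻¹) atTop (𝓝 0) := by
    simpa using hinv.const_mul 2
  have hlarge : ∀ᶠ N : ℕ in atTop, 2 ≤ a * N :=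
    (tendsto_natCast_atTop_atTop.const_mul_atTop ha).eventually_ge_atTop 2
  refine tendsto_of_tendsto_of_tendsto_of_le_of_le' hlow hup ?_ ?_
  · filter_upwards [eventually_ge_atTop 1] with N hN
    have hN' : (0 : ℝ) < N := by positivity
    have h := Real.le_log_Gamma (x := a * N) (by positivity)
    rw [le_div_iff₀ hN', sub_mul, div_mul_cancel₀ _ hN'.ne', inv_mul_cancel_right₀ hN'.ne']
    have h1 : Real.log (a * N) = Real.log a + Real.log N := Real.log_mul ha.ne' hN'.ne'
    linarith
  · filter_upwards [hlarge, eventually_ge_atTop 1] with N h2 hN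
    have hN' : (0 : ℝ) < N := by positivity
    have h := Real.log_Gamma_le h2
    rw [div_le_iff₀ hN', inv_mul_cancel_right₀ hN'.ne']
    linarith

end Gamma

namespace SteadyState

/-! ### The limiting one-particle density -/

section Marginal

variable {d : ℕ} {α : ℝ}

theorem limitDensity_pos (hd : 1 ≤ d) (hα : -2 < α) (v : Vel d) : 0 < limitDensity d α v := by
  have hc := constC_pos hd hα
  have hμ := constMu_pos hd hα
  unfold limitDensity
  positivity

/-- Rescaling `limitDensity` gives back the density of `particleLaw`, up to the Jacobian. -/
theorem limitDensity_smul (hd : 1 ≤ d) (hα : -2 < α) (v : Vel d) :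
    limitDensity d α ((√(constMu d α))⁻¹ • v) =
      (√(constMu d α)) ^ d * (Real.exp (-‖v‖ ^ (2 + α)) / constC d α) := by
  have hμ := constMu_pos hd hα
  have hs : 0 < √(constMu d α) := Real.sqrt_pos.mpr hμ
  rw [limitDensity, norm_smul, Real.norm_eq_abs, abs_of_pos (inv_pos.mpr hs),
    mul_inv_cancel_left₀ hs.ne', Real.rpow_div_two_eq_sqrt _ hμ.le,
    Real.rpow_natCast]
  ring

/-- `limitDensity` is the density of a velocity with law `particleLaw`, rescaled to unit second
moment. -/
theorem integral_mul_limitDensity (hd : 1 ≤ d) (hα : -2 < α) (h : Vel d → ℝ) :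
    ∫ v, h v * limitDensity d α v = ∫ v, h ((√(constMu d α))⁻¹ • v) ∂(particleLaw d α) := by
  have hμ := constMu_pos hd hα
  have hs : 0 < √(constMu d α) := Real.sqrt_pos.mpr hμ
  have key := Measure.integral_comp_smul (volume : Measure (Vel d))
    (fun v => h v * limitDensity d α v) (√(constMu d α))⁻¹
  rw [finrank_euclideanSpace_fin, abs_of_pos (by positivity), inv_pow, inv_inv, smul_eq_mul] at key
  simp only [limitDensity_smul hd hα] at key
  rw [integral_particleLaw hd hα, ← mul_right_inj' (pow_ne_zero d hs.ne'), ← key,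
    ← integral_const_mul, ← integral_const_mul]
  refine integral_congr_ae (Eventually.of_forall fun v => ?_)
  simp only
  ring

theorem integrable_mul_limitDensity (hd : 1 ≤ d) (hα : -2 < α) {h : Vel d → ℝ}
    (hi : Integrable (fun v => h ((√(constMu d α))⁻¹ • v)) (particleLaw d α)) :
    Integrable fun v => h v * limitDensity d α v := by
  have hμ := constMu_pos hd hα
  have hs : 0 < √(constMu d α) := Real.sqrt_pos.mpr hμ
  rw [integrable_particleLaw_iff hd hα] at hi
  rw [← integrable_comp_smul_iff volume _ (inv_ne_zero hs.ne')]
  refine (hi.const_mul ((√(constMu d α)) ^ d / constC d α)).congr (Eventually.of_forall fun v => ?_)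
  simp only [limitDensity_smul hd hα]
  ring

theorem isProbDensity_limitDensity (hd : 1 ≤ d) (hα : -2 < α) :
    IsProbDensity volume (limitDensity d α) := by
  have := isProbabilityMeasure_particleLaw hd hα
  refine ⟨Eventually.of_forall fun v => (limitDensity_pos hd hα v).le, ?_, ?_⟩
  · simpa using integrable_mul_limitDensity hd hα (h := fun _ => 1) (integrable_const _)
  · simpa using integral_mul_limitDensity hd hα (fun _ => 1)

theorem log_limitDensity_smul (hd : 1 ≤ d) (hα : -2 < α) (v : Vel d) :
    Real.log (limitDensity d α ((√(constMu d α))⁻¹ • v)) =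
      Real.log (constMu d α ^ ((d : ℝ) / 2) / constC d α) - ‖v‖ ^ (2 + α) := by
  have hc := constC_pos hd hα
  have hμ := constMu_pos hd hα
  have hs : 0 < √(constMu d α) := Real.sqrt_pos.mpr hμ
  rw [limitDensity, norm_smul, Real.norm_eq_abs, abs_of_pos (inv_pos.mpr hs),
    mul_inv_cancel_left₀ hs.ne', Real.log_mul (by positivity) (Real.exp_pos _).ne', Real.log_exp,
    sub_eq_add_neg]

theorem integrable_limitDensity_mul_log (hd : 1 ≤ d) (hα : -2 < α) :
    Integrable (fun v => limitDensity d α v * Real.log (limitDensity d α v)) volume := by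
  have := isProbabilityMeasure_particleLaw hd hα
  simp_rw [mul_comm (limitDensity d α _)]
  refine integrable_mul_limitDensity hd hα (h := fun v => Real.log (limitDensity d α v)) ?_
  simp only [log_limitDensity_smul hd hα]
  exact (integrable_const _).sub (integrable_norm_rpow_particleLaw hd hα (by linarith))

theorem integral_limitDensity_mul_log (hd : 1 ≤ d) (hα : -2 < α) :
    ∫ v, limitDensity d α v * Real.log (limitDensity d α v) =
      Real.log (constMu d α ^ ((d : ℝ) / 2) / constC d α) - (d : ℝ) / (2 + α) := by
  have := isProbabilityMeasure_particleLaw hd hα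
  simp_rw [mul_comm (limitDensity d α _)]
  rw [integral_mul_limitDensity hd hα (fun v => Real.log (limitDensity d α v))]
  simp only [log_limitDensity_smul hd hα]
  rw [integral_sub (integrable_const _) (integrable_norm_rpow_particleLaw hd hα (by linarith)),
    integral_norm_rpow_particleLaw hd hα]
  simp

theorem integral_mul_prod_limitDensity (hd : 1 ≤ d) (hα : -2 < α) {k : ℕ}
    {φ : (Fin k → Vel d) → ℝ} (hφ : Measurable φ) :
    ∫ v : Fin k → Vel d, φ v * ∏ j, limitDensity d α (v j) =
      ∫ ω, φ (fun j => (√(constMu d α))⁻¹ • ω j) ∂(iidLaw d α) := by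
  have hc := constC_pos hd hα
  have hμ := constMu_pos hd hα
  have hs : 0 < √(constMu d α) := Real.sqrt_pos.mpr hμ
  have hm : Measurable fun v : Fin k → Vel d => φ ((√(constMu d α))⁻¹ • v) := by fun_prop
  have hright : ∫ ω, φ (fun j => (√(constMu d α))⁻¹ • ω j) ∂(iidLaw d α) =
      ∫ v : Fin k → Vel d, φ ((√(constMu d α))⁻¹ • v) ∂(Measure.pi fun _ => particleLaw d α) := by
    rw [← map_restrict_iidLaw hd hα k, integral_map (Measurable.aemeasurable (by fun_prop))
      hm.aestronglyMeasurable]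
    rfl
  have key := Measure.integral_comp_smul (volume : Measure (Fin k → Vel d))
    (fun v => φ v * ∏ j, limitDensity d α (v j)) (√(constMu d α))⁻¹
  rw [abs_of_pos (by positivity), inv_pow, inv_inv, smul_eq_mul] at key
  simp only [Pi.smul_apply, limitDensity_smul hd hα] at key
  have hpi : Measure.pi (fun _ : Fin k => particleLaw d α) =
      (volume : Measure (Fin k → Vel d)).withDensity fun v =>
        ENNReal.ofReal (∏ i, (Real.exp (-‖v i‖ ^ (2 + α)) / constC d α)) :=
    Measure.pi_withDensity_ofReal volume _ (fun v => by positivity)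
      ((integrable_exp_neg_norm_rpow hd hα).div_const _)
  rw [hright, hpi, integral_withDensity_eq_integral_toReal_smul (by fun_prop)
    (Eventually.of_forall fun _ => ENNReal.ofReal_lt_top),
    ← mul_right_inj' (pow_ne_zero (Module.finrank ℝ (Fin k → Vel d)) hs.ne'), ← key,
    ← integral_const_mul]
  refine integral_congr_ae (Eventually.of_forall fun v => ?_)
  simp only [Finset.prod_mul_distrib, smul_eq_mul]
  rw [ENNReal.toReal_ofReal (Finset.prod_nonneg fun _ _ => by positivity),
    Module.finrank_pi_fintype]
  simp only [finrank_euclideanSpace_fin, Finset.prod_const, Finset.sum_const, Finset.card_univ,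
    Fintype.card_fin, smul_eq_mul]
  rw [← pow_mul, mul_comm d k]
  ring

end Marginal

/-! ### The stationary density and its entropy -/

section Density

variable {d : ℕ} {α : ℝ}

theorem abs_mul_log_le {r : ℝ} (hr : 0 ≤ r) : |r * Real.log r| ≤ 1 + r ^ 2 := by
  rcases hr.eq_or_lt with rfl | hr
  · simp
  have h1 := Real.log_le_sub_one_of_pos hr
  have h2 := Real.one_sub_inv_le_log_of_pos hr
  have h3 : r * (1 - r⁻¹) = r - 1 := by field_simp
  rw [abs_le]
  constructor
  · nlinarith [mul_le_mul_of_nonneg_left h2 hr.le]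
  · nlinarith [mul_le_mul_of_nonneg_left h1 hr.le]

theorem ae_speedMean_pos (hd : 1 ≤ d) (hα : -2 < α) {N : ℕ} (hN : 1 ≤ N) :
    ∀ᵐ ω ∂(iidLaw d α), 0 < speedMean α (sphereConf d N ω) := by
  filter_upwards [ae_initialConf_ne_zero hd hα] with ω hω
  have h0 : sphereConf d N ω ≠ 0 := by
    rw [← norm_pos_iff, norm_sphereConf (hω N hN)]
    positivity
  have := powSum_pos (α := α) h0
  unfold speedMean
  positivity

theorem integrable_speedMean (hd : 1 ≤ d) (hα : -2 < α) (N : ℕ) :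
    Integrable (fun ω => speedMean α (sphereConf d N ω)) (iidLaw d α) := by
  simpa using integrable_speedMean_pow hd hα N 1

theorem integral_speedMean_pos (hd : 1 ≤ d) (hα : -2 < α) {N : ℕ} (hN : 1 ≤ N) :
    0 < ∫ ω, speedMean α (sphereConf d N ω) ∂(iidLaw d α) := by
  have hprob := isProbabilityMeasure_iidLaw hd hα
  rw [integral_pos_iff_support_of_nonneg (fun _ => speedMean_nonneg _)
    (integrable_speedMean hd hα N)]
  have : (Function.support fun ω => speedMean α (sphereConf d N ω)) =ᵐ[iidLaw d α] Set.univ := by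
    filter_upwards [ae_speedMean_pos hd hα hN] with ω hω
    exact propext ⟨fun _ => trivial, fun _ => hω.ne'⟩
  rw [measure_congr this, measure_univ]
  exact one_pos

theorem integrable_speedMean_mul_log (hd : 1 ≤ d) (hα : -2 < α) (N : ℕ) :
    Integrable (fun ω => speedMean α (sphereConf d N ω) *
      Real.log (speedMean α (sphereConf d N ω))) (iidLaw d α) := by
  have hprob := isProbabilityMeasure_iidLaw hd hα
  have hm : Measurable fun ω => speedMean α (sphereConf d N ω) :=
    measurable_speedMean.comp (measurable_sphereConf N)
  exact ((integrable_const 1).add (integrable_speedMean_pow hd hα N 2)).mono'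
    (hm.mul hm.log).aestronglyMeasurable
    (Eventually.of_forall fun ω => abs_mul_log_le (speedMean_nonneg _))

theorem normalization_eq (hd : 1 ≤ d) (hα : -2 < α) {N : ℕ} (hN : 1 ≤ N) :
    normalization d α N =
      (∫ ω, speedMean α (sphereConf d N ω) ∂(iidLaw d α)) / weightFactor d α N := by
  have hK := weightFactor_pos hd hα hN
  have h := integral_speedMean_iidLaw hd hα hN (φ := fun _ => 1) measurable_const
  simp only [one_mul] at h
  rw [h, normalization, mul_div_cancel_left₀ _ hK.ne']

theorem normalization_pos (hd : 1 ≤ d) (hα : -2 < α) {N : ℕ} (hN : 1 ≤ N) :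
    0 < normalization d α N := by
  rw [normalization_eq hd hα hN]
  exact div_pos (integral_speedMean_pos hd hα hN) (weightFactor_pos hd hα hN)

/-- Expectations under the stationary density are expectations over independent velocities,
projected to the energy sphere and reweighted by the power mean of the speeds. -/
theorem integral_mul_steadyDensity (hd : 1 ≤ d) (hα : -2 < α) {N : ℕ} (hN : 1 ≤ N)
    {φ : Conf d N → ℝ} (hφ : Measurable φ) :
    ∫ V, φ V * steadyDensity d α N V ∂(energySurface d N) =
      (∫ ω, φ (sphereConf d N ω) * speedMean α (sphereConf d N ω) ∂(iidLaw d α)) /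
        ∫ ω, speedMean α (sphereConf d N ω) ∂(iidLaw d α) := by
  have hK := weightFactor_pos hd hα hN
  have hE := integral_speedMean_pos hd hα hN
  have : ∀ V, φ V * steadyDensity d α N V = 1 / normalization d α N * (φ V * weight d α N V) :=
    fun V => by rw [steadyDensity]; ring
  simp_rw [this]
  rw [integral_const_mul, integral_speedMean_iidLaw hd hα hN hφ, normalization_eq hd hα hN]
  field_simp

theorem integrable_mul_steadyDensity (hd : 1 ≤ d) (hα : -2 < α) {N : ℕ} (hN : 1 ≤ N)
    {φ : Conf d N → ℝ} (hφ : Measurable φ)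
    (hi : Integrable (fun ω => φ (sphereConf d N ω) * speedMean α (sphereConf d N ω))
      (iidLaw d α)) :
    Integrable (fun V => φ V * steadyDensity d α N V) (energySurface d N) := by
  have : ∀ V, φ V * steadyDensity d α N V = 1 / normalization d α N * (φ V * weight d α N V) :=
    fun V => by rw [steadyDensity]; ring
  simp_rw [this]
  exact (integrable_mul_weight hd hα hN hφ hi).const_mul _

theorem isProbDensity_steadyDensity (hd : 1 ≤ d) (hα : -2 < α) {N : ℕ} (hN : 1 ≤ N) :
    IsProbDensity (energySurface d N) (steadyDensity d α N) := by
  have hE := integral_speedMean_pos hd hα hN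
  refine ⟨?_, ?_, ?_⟩
  · refine Eventually.of_forall fun V => ?_
    have := normalization_pos hd hα hN
    unfold steadyDensity weight
    positivity
  · simpa using integrable_mul_steadyDensity hd hα hN (φ := fun _ => 1) measurable_const
      (by simpa using integrable_speedMean hd hα N)
  · simpa [hE.ne'] using integral_mul_steadyDensity hd hα hN (φ := fun _ => 1) measurable_const

/-- The logarithm of the stationary density, as a function of the power mean of the speeds. -/
theorem log_steadyDensity (hd : 1 ≤ d) (hα : -2 < α) {N : ℕ} (hN : 1 ≤ N) {V : Conf d N}
    (hV : V ≠ 0) :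
    Real.log (steadyDensity d α N V) =
      -Real.log (normalization d α N) - ((d : ℝ) * N - 1) / (2 + α) * Real.log N -
        ((d : ℝ) * N - 1) * Real.log (speedMean α V) := by
  have hp : 0 < 2 + α := by linarith
  have hZ := normalization_pos hd hα hN
  have hS := powSum_pos (α := α) hV
  have hN' : (0 : ℝ) < N := by positivity
  rw [steadyDensity, weight, ← powSum, Real.log_mul (by positivity) (by positivity), one_div,
    one_div, Real.log_inv, Real.log_inv, Real.log_rpow hS, speedMean,
    Real.log_rpow (by positivity), Real.log_div hS.ne' hN'.ne']
  field_simp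
  ring

theorem ae_steadyDensity_mul_log (hd : 1 ≤ d) (hα : -2 < α) {N : ℕ} (hN : 1 ≤ N) :
    (fun V => steadyDensity d α N V * Real.log (steadyDensity d α N V)) =ᵐ[energySurface d N]
      fun V => (-Real.log (normalization d α N) - ((d : ℝ) * N - 1) / (2 + α) * Real.log N -
        ((d : ℝ) * N - 1) * Real.log (speedMean α V)) * steadyDensity d α N V := by
  filter_upwards [ae_ne_zero_energySurface hN] with V hV
  rw [log_steadyDensity hd hα hN hV, mul_comm]

theorem integrable_sub_log_speedMean_mul (hd : 1 ≤ d) (hα : -2 < α) (N : ℕ) (a b : ℝ) :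
    Integrable (fun ω => (a - b * Real.log (speedMean α (sphereConf d N ω))) *
      speedMean α (sphereConf d N ω)) (iidLaw d α) := by
  refine (((integrable_speedMean hd hα N).const_mul a).sub
    ((integrable_speedMean_mul_log hd hα N).const_mul b)).congr (Eventually.of_forall fun ω => ?_)
  simp only [Pi.sub_apply]
  ring

theorem integrable_steadyDensity_mul_log (hd : 1 ≤ d) (hα : -2 < α) {N : ℕ} (hN : 1 ≤ N) :
    Integrable (fun V => steadyDensity d α N V * Real.log (steadyDensity d α N V))
      (energySurface d N) := by
  rw [integrable_congr (ae_steadyDensity_mul_log hd hα hN)]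
  have hm := measurable_speedMean (d := d) (α := α) (N := N)
  exact integrable_mul_steadyDensity hd hα hN (by fun_prop)
    (integrable_sub_log_speedMean_mul hd hα N _ _)

/-- The entropy in closed form, up to two expectations over independent velocities. -/
theorem entropy_steadyDensity (hd : 1 ≤ d) (hα : -2 < α) {N : ℕ} (hN : 1 ≤ N) :
    entropy d N (steadyDensity d α N) =
      -Real.log (normalization d α N) - ((d : ℝ) * N - 1) / (2 + α) * Real.log N -
        ((d : ℝ) * N - 1) *
          ((∫ ω, speedMean α (sphereConf d N ω) * Real.log (speedMean α (sphereConf d N ω))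
            ∂(iidLaw d α)) / ∫ ω, speedMean α (sphereConf d N ω) ∂(iidLaw d α)) := by
  have hE := integral_speedMean_pos hd hα hN
  have hm := measurable_speedMean (d := d) (α := α) (N := N)
  rw [entropy, integral_congr_ae (ae_steadyDensity_mul_log hd hα hN),
    integral_mul_steadyDensity hd hα hN (φ := fun V =>
      -Real.log (normalization d α N) - ((d : ℝ) * N - 1) / (2 + α) * Real.log N -
        ((d : ℝ) * N - 1) * Real.log (speedMean α V)) (by fun_prop)]
  have : ∀ ω, (-Real.log (normalization d α N) - ((d : ℝ) * N - 1) / (2 + α) * Real.log N -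
        ((d : ℝ) * N - 1) * Real.log (speedMean α (sphereConf d N ω))) *
          speedMean α (sphereConf d N ω) =
      (-Real.log (normalization d α N) - ((d : ℝ) * N - 1) / (2 + α) * Real.log N) *
          speedMean α (sphereConf d N ω) - ((d : ℝ) * N - 1) *
        (speedMean α (sphereConf d N ω) * Real.log (speedMean α (sphereConf d N ω))) := by
    intro ω
    ring
  simp_rw [this]
  rw [integral_sub ((integrable_speedMean hd hα N).const_mul _)
    ((integrable_speedMean_mul_log hd hα N).const_mul _), integral_const_mul, integral_const_mul]
  field_simp

end Density

/-! ### Chaoticity and convergence of the entropy per particle -/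

section Conclusion

variable {d : ℕ} {α : ℝ}

theorem tendsto_integral_speedMean (hd : 1 ≤ d) (hα : -2 < α) {u : ℕ → ℕ}
    (hu : Tendsto u atTop atTop) :
    Tendsto (fun n => ∫ ω, speedMean α (sphereConf d (u n) ω) ∂(iidLaw d α)) atTop
      (𝓝 (limitSpeedMean d α)) := by
  have hprob := isProbabilityMeasure_iidLaw hd hα
  have := tendsto_integral_mul_speedMean hd hα hu (ψ := fun _ _ => 1) (ψ' := fun _ => 1) (b := 1)
    (fun _ => measurable_const) measurable_const (by simp) (by simp)
    (Eventually.of_forall fun _ => tendsto_const_nhds) (h := id) measurable_id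
    (fun r hr => by
      rw [id, abs_of_nonneg hr]
      nlinarith [sq_nonneg (r - 1)]) continuousAt_id
  simpa using this

theorem tendsto_integral_speedMean_mul_log (hd : 1 ≤ d) (hα : -2 < α) :
    Tendsto (fun N => ∫ ω, speedMean α (sphereConf d N ω) *
      Real.log (speedMean α (sphereConf d N ω)) ∂(iidLaw d α)) atTop
      (𝓝 (limitSpeedMean d α * Real.log (limitSpeedMean d α))) := by
  have hprob := isProbabilityMeasure_iidLaw hd hα
  have hρ := limitSpeedMean_pos hd hα
  have := tendsto_integral_mul_speedMean hd hα tendsto_id (ψ := fun _ _ => 1) (ψ' := fun _ => 1)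
    (b := 1) (fun _ => measurable_const) measurable_const (by simp) (by simp)
    (Eventually.of_forall fun _ => tendsto_const_nhds) (h := fun r => r * Real.log r)
    (by fun_prop) (fun r hr => abs_mul_log_le hr) Real.continuous_mul_log.continuousAt
  simpa using this

theorem measurable_conf_apply {N : ℕ} (i : Fin N) : Measurable fun V : Conf d N => V i := by
  fun_prop

theorem isChaotic_steadyDensity (hd : 1 ≤ d) (hα : -2 < α) :
    IsChaotic d (steadyDensity d α) (limitDensity d α) := by
  refine ⟨fun N hN => isProbDensity_steadyDensity hd hα hN, isProbDensity_limitDensity hd hα,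
    fun k φ => ?_⟩
  have hρ := limitSpeedMean_pos hd hα
  have hu : Tendsto (fun m : ℕ => k + m) atTop atTop := 
    tendsto_atTop_mono (fun m => Nat.le_add_left m k) tendsto_id
  have hφm : Measurable φ := φ.continuous.measurable
  have hψm : ∀ m, Measurable fun ω =>
      φ fun j : Fin k => sphereConf d (k + m) ω (Fin.castAdd m j) := fun m =>
    hφm.comp (measurable_pi_lambda _ fun j => (measurable_conf_apply _).comp
      (measurable_sphereConf (k + m)))
  have hψm' : Measurable fun ω : ℕ → Vel d => φ fun j : Fin k => (√(constMu d α))⁻¹ • ω j :=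
    hφm.comp (measurable_pi_lambda _ fun j =>
      (continuous_const_smul _).measurable.comp (measurable_pi_apply _))
  have hψ : ∀ᵐ ω ∂(iidLaw d α), Tendsto
      (fun m => φ fun j : Fin k => sphereConf d (k + m) ω (Fin.castAdd m j)) atTop
      (𝓝 (φ fun j : Fin k => (√(constMu d α))⁻¹ • ω j)) := by
    filter_upwards [ae_tendsto_sphereConf hd hα] with ω hω
    exact (φ.continuous.tendsto _).comp (tendsto_pi_nhds.mpr fun j => (hω j).comp hu)
  have hnum := tendsto_integral_mul_speedMean hd hα hu (b := ‖φ‖) hψm hψm'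
    (fun _ _ => φ.norm_coe_le_norm _) (fun _ => φ.norm_coe_le_norm _) hψ (h := id) measurable_id
    (fun r hr => by
      rw [id, abs_of_nonneg hr]
      nlinarith [sq_nonneg (r - 1)]) continuousAt_id
  have hlim := hnum.div (tendsto_integral_speedMean hd hα hu) hρ.ne'
  rw [id, mul_div_cancel_right₀ _ hρ.ne', ← integral_mul_prod_limitDensity hd hα hφm] at hlim
  refine hlim.congr' ?_
  filter_upwards [eventually_ge_atTop 1] with m hm
  have hφm' : Measurable fun V : Conf d (k + m) => φ fun j : Fin k => V (Fin.castAdd m j) :=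
    hφm.comp (measurable_pi_lambda _ fun j => measurable_conf_apply _)
  rw [integral_mul_steadyDensity hd hα (hm.trans (Nat.le_add_left m k)) hφm']
  rfl

theorem log_weightFactor (hd : 1 ≤ d) (hα : -2 < α) {N : ℕ} (hN : 1 ≤ N) :
    Real.log (weightFactor d α N) =
      -(N * Real.log (constC d α)) + Real.log (Real.Gamma (d / (2 + α) * N)) -
        Real.log (2 + α) + (1 / 2 - 1 / (2 + α)) * Real.log N := by
  have hp : 0 < 2 + α := by linarith
  have hc := constC_pos hd hα
  have hN' : (0 : ℝ) < N := by positivity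
  have hG : 0 < Real.Gamma (d * N / (2 + α)) := Real.Gamma_pos_of_pos (by positivity)
  rw [weightFactor, Real.log_mul (by positivity) (by positivity),
    Real.log_mul (by positivity) (by positivity), Real.log_mul (by positivity) (by positivity),
    Real.log_div hG.ne' hp.ne', Real.log_pow, Real.log_inv, Real.log_rpow hN',
    Real.log_sqrt hN'.le, show (d : ℝ) / (2 + α) * N = d * N / (2 + α) by ring]
  ring

theorem tendsto_entropy_steadyDensity (hd : 1 ≤ d) (hα : -2 < α) :
    Tendsto (fun N : ℕ => entropy d N (steadyDensity d α N) / (N : ℝ)) atTop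
      (𝓝 (Real.log (constMu d α ^ ((d : ℝ) / 2) / constC d α) - (d : ℝ) / (2 + α))) := by
  have hp : 0 < 2 + α := by linarith
  have hc := constC_pos hd hα
  have hμ := constMu_pos hd hα
  have hρ := limitSpeedMean_pos hd hα
  set a : ℝ := d / (2 + α) with ha
  have hapos : 0 < a := by positivity
  have hinv : Tendsto (fun N : ℕ => (N : ℝ)⁻¹) atTop (𝓝 0) := tendsto_inv_atTop_nhds_zero_nat
  have hE := tendsto_integral_speedMean hd hα tendsto_id
  simp only [id] at hE
  have hquot := (tendsto_integral_speedMean_mul_log hd hα).div hE hρ.ne'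
  rw [mul_div_cancel_left₀ _ hρ.ne'] at hquot
  have hlogE := (hE.log hρ.ne').mul hinv
  have hlim := ((((hlogE.neg).sub (hinv.const_mul (Real.log (2 + α)))).add
    (tendsto_log_natCast_div.const_mul (1 / 2))).add
    ((tendsto_log_Gamma_mul_natCast hapos).add_const
      (a * Real.log a - a - Real.log (constC d α)))).sub
    (((tendsto_const_nhds (x := (d : ℝ))).sub hinv).mul hquot)
  -- The limits of the individual terms; the terms of order `log N` cancel in the last step below.
  have hval : -(Real.log (limitSpeedMean d α) * 0) - Real.log (2 + α) * 0 + 1 / 2 * 0 +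
      (0 + (a * Real.log a - a - Real.log (constC d α))) -
      (d - 0) * Real.log (limitSpeedMean d α) =
      Real.log (constMu d α ^ ((d : ℝ) / 2) / constC d α) - a := by
    rw [limitSpeedMean, ← ha, Real.log_div (by positivity) (by positivity), Real.log_rpow hapos,
      Real.log_sqrt hμ.le, Real.log_div (by positivity) hc.ne', Real.log_rpow hμ]
    have : (d : ℝ) * (1 / (2 + α) * Real.log a) = a * Real.log a := by rw [ha]; ring
    linear_combination -this
  rw [hval] at hlim
  simp only [Pi.div_apply] at hlim
  refine hlim.congr' ?_
  filter_upwards [eventually_ge_atTop 1] with N hN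
  have hN' : (0 : ℝ) < N := by positivity
  have hEN := integral_speedMean_pos hd hα hN
  rw [entropy_steadyDensity hd hα hN, normalization_eq hd hα hN,
    Real.log_div hEN.ne' (weightFactor_pos hd hα hN).ne', log_weightFactor hd hα hN, ← ha,
    Real.log_mul hapos.ne' hN'.ne',
    show ((d : ℝ) * N - 1) / (2 + α) = a * N - 1 / (2 + α) by rw [ha]; ring]
  field_simp
  ring

theorem isEntropicallyChaotic_steadyDensity (hd : 1 ≤ d) (hα : -2 < α) :
    IsEntropicallyChaotic d (steadyDensity d α) (limitDensity d α) where
  chaotic := isChaotic_steadyDensity hd hα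
  integrable_entropy _ hN := integrable_steadyDensity_mul_log hd hα hN
  integrable_marginal_entropy := integrable_limitDensity_mul_log hd hα
  tendsto_entropy := by
    rw [integral_limitDensity_mul_log hd hα]
    exact tendsto_entropy_steadyDensity hd hα

end Conclusion

end SteadyState

theorem mainTheorem2 (d : ℕ) (hd : 1 ≤ d) (α : ℝ) (hα : -2 < α) :
    SteadyState.IsEntropicallyChaotic d
        (SteadyState.steadyDensity d α) (SteadyState.limitDensity d α) ∧
      Tendsto
        (fun N : ℕ => (N : ℝ)⁻¹ *
          ∫ V, SteadyState.steadyDensity d α N V * Real.log (SteadyState.steadyDensity d α N V)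
            ∂(SteadyState.energySurface d N))
        atTop
        (𝓝 (Real.log (SteadyState.constMu d α ^ ((d : ℝ) / 2) / SteadyState.constC d α)
          - (d : ℝ) / (2 + α))) ∧
      Real.log (SteadyState.constMu d α ^ ((d : ℝ) / 2) / SteadyState.constC d α)
          - (d : ℝ) / (2 + α) =
        ∫ v, SteadyState.limitDensity d α v * Real.log (SteadyState.limitDensity d α v) := by
  refine ⟨SteadyState.isEntropicallyChaotic_steadyDensity hd hα, ?_,
    (SteadyState.integral_limitDensity_mul_log hd hα).symm⟩
  refine (SteadyState.tendsto_entropy_steadyDensity hd hα).congr fun N => ?_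
  rw [div_eq_inv_mul, SteadyState.entropy]
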